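/- Let $k$ be a field and let $A=(A,n)$ be a Hurwitz algebra over $k$, i.e. a non-zero finite-dimensional, unital, not necessarily associative $k$-algebra with a quadratic form $n$ satisfying $n(xy)=n(x)n(y)$ whose polar form $\langle x,y\rangle=n(x+y)-n(x)-n(y)$ is non-degenerate. For $a\in A$ put $L_a(x)=ax$ and $R_a(x)=xa$. For $\alpha,\beta\in GL(A)$ let $A_{\alpha,\beta}$ be the vector space $A$ with the multiplication $x\circ y=\alpha(x)\beta(y)$. Let $GO(A)$ be the group of similitudes of $(A,n)$, i.e. of the $\varphi\in GL(A)$ such that $n(\varphi(x))=\mu(\varphi)n(x)$ for all $x$, with $\mu(\varphi)\in k$ independent of $x$; when $\dim A$ is even, let $GO^+(A)$ be the subgroup of proper similitudes, i.e. those with $\det\varphi=\mu(\varphi)^{\dim A/2}$ if $\operatorname{char}k\neq 2$, and those with Dickson invariant $0$ if $\operatorname{char}k=2$. Put $G(A)=GO(A)$ if $\dim A\le 2$ and $G(A)=GO^+(A)$ if $\dim A\ge 4$. Triality components of $\varphi\in GO(A)$ are maps $\varphi_1,\varphi_2\in GO(A)$ with $\varphi(xy)=\varphi_1(x)\varphi_2(y)$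 for all $x,y\in A$. 1. Every $\varphi\in G(A)$ has triality components $\varphi_1,\varphi_2\in G(A)$. For any triality components $\varphi_1,\varphi_2$ of $\varphi\in G(A)$, the maps $R_{\varphi_2(1)}$ and $L_{\varphi_1(1)}$ are invertible, $\varphi_1=R_{\varphi_2(1)}^{-1}\varphi$, $\varphi_2=L_{\varphi_1(1)}^{-1}\varphi$, and for all $\alpha,\beta\in GL(A)$ the map $\varphi$ is an isomorphism of algebras $A_{\alpha,\beta}\to A_{\gamma,\delta}$, where $$\gamma=\varphi_1\alpha\varphi^{-1}=R_{\varphi_2(1)}^{-1}\varphi\alpha\varphi^{-1},\qquad \delta=\varphi_2\beta\varphi^{-1}=L_{\varphi_1(1)}^{-1}\varphi\beta\varphi^{-1}.$$ 2. Conversely, for all $\alpha,\beta,\gamma,\delta\in GL(A)$, every isomorphism $A_{\alpha,\beta}\to A_{\gamma,\delta}$ lies in $G(A)$. In particular, if $\dim A\ge 4$, then an improper similitude (an element of $GO(A)\setminus GO^+(A)$) is never an isomorphism $A_{\alpha,\beta}\to A_{\gamma,\delta}$. -/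

import Mathlib

namespace HurwitzIsotope

variable {k A : Type*} [Field k]

section Quadratic

variable [AddCommGroup A] [Module k A]

/-- `φ` is a similitude of the quadratic space `(A, n)` with multiplier `μ`. -/
def HasMultiplier (n : QuadraticForm k A) (φ : A ≃ₗ[k] A) (μ : k) : Prop :=
  ∀ x, n (φ x) = μ * n x

/-- The similitudes of `(A, n)`. -/
def GO (n : QuadraticForm k A) : Set (A ≃ₗ[k] A) :=
  {φ | ∃ μ : k, HasMultiplier n φ μ}

/-- In characteristic two: the similitude `φ` has Dickson invariant `d`.
Choose a (not necessarily symmetric) bilinear form `B` with `B x x = n x`. If `μ` is the multiplier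
of `φ`, then `B (φ x) (φ y) - μ B x y` is alternating, hence equals `r x y - r y x` for a bilinear
form `r`. Write `r x y = ⟨T x, y⟩` with `⟨ , ⟩` the polar form of `n`; the Dickson invariant is
`μ⁻¹ tr T`, which lies in `{0, 1}` and does not depend on the choices of `B` and `r`.
(In matrices, with `a`, `w = a + aᵗ` and `r` the Gram matrices of `B`, of the polar form and of `r`,
it is `μ⁻¹ tr (w⁻¹ r)` where `gᵗ a g - μ a = r - rᵗ`.) -/
def HasDicksonInvariant (n : QuadraticForm k A) (φ : A ≃ₗ[k] A) (d : k) : Prop :=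
  ∃ (μ : k) (B : LinearMap.BilinForm k A) (T : Module.End k A),
    HasMultiplier n φ μ ∧
    (∀ x, B x x = n x) ∧
    (∀ x y, B (φ x) (φ y) - μ * B x y =
      QuadraticMap.polar n (T x) y - QuadraticMap.polar n (T y) x) ∧
    LinearMap.trace k A T = μ * d

/-- The proper similitudes of an even-dimensional quadratic space `(A, n)`: those with
`det φ = μ(φ) ^ (dim A / 2)` if `char k ≠ 2`, and those with Dickson invariant zero
if `char k = 2`. -/
def GOPlus (n : QuadraticForm k A) : Set (A ≃ₗ[k] A) :=
  {φ | φ ∈ GO n ∧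
    (ringChar k ≠ 2 → ∃ μ : k, HasMultiplier n φ μ ∧
      LinearMap.det (φ : A →ₗ[k] A) = μ ^ (Module.finrank k A / 2)) ∧
    (ringChar k = 2 → HasDicksonInvariant n φ 0)}

open Classical in
/-- The group `G(A)`: all similitudes if `dim A ≤ 2`, the proper similitudes otherwise. -/
noncomputable def G (n : QuadraticForm k A) : Set (A ≃ₗ[k] A) :=
  if Module.finrank k A ≤ 2 then GO n else GOPlus n

/-- The isomorphisms from the algebra `(A, m)` to the algebra `(A, m')`, where `m` and `m'` are
bilinear multiplications on the vector space `A`. -/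
def Iso (m m' : A →ₗ[k] A →ₗ[k] A) : Set (A ≃ₗ[k] A) :=
  {φ | ∀ x y, φ (m x y) = m' (φ x) (φ y)}

end Quadratic

variable [NonAssocRing A] [Module k A] [IsScalarTower k A A] [SMulCommClass k A A]

/-- A non-zero unital, not necessarily associative, `k`-algebra `A` is a Hurwitz algebra with
norm `n`: the quadratic form `n` is multiplicative and its polar form is non-degenerate. -/
structure IsHurwitz (n : QuadraticForm k A) : Prop where
  nontrivial : Nontrivial A
  nondegenerate : ∀ x, (∀ y, QuadraticMap.polar n x y = 0) → x = 0
  norm_mul : ∀ x y, n (x * y) = n x * n y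

/-- The multiplication `x ∘ y = α(x) β(y)` of the principal isotope `A_{α,β}`. -/
def isotope (α β : A ≃ₗ[k] A) : A →ₗ[k] A →ₗ[k] A :=
  (LinearMap.mul k A).compl₁₂ (α : A →ₗ[k] A) (β : A →ₗ[k] A)

/-- `φ₁, φ₂` are triality components of `φ`. -/
def IsTriality (n : QuadraticForm k A) (φ φ₁ φ₂ : A ≃ₗ[k] A) : Prop :=
  φ₁ ∈ GO n ∧ φ₂ ∈ GO n ∧ ∀ x y, φ (x * y) = φ₁ x * φ₂ y

end HurwitzIsotope

namespace HurwitzIsotope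

open QuadraticMap (polar)
open Module (finrank)

/-! ### Reflections and isometries of non-degenerate quadratic spaces. -/

section QuadraticSpace

variable {k V : Type*} [Field k] [AddCommGroup V] [Module k V] {n : QuadraticForm k V}

/-! The whole statement reduces to one equality (`mem_G_iff`): `G(A)` is the group `autotopy` of all
`φ` with `φ(xy) = φ₁(x)φ₂(y)` for some linear bijections `φ₁, φ₂`. An isomorphism of principal
isotopes is exactly such a `φ`, with `φ₁ = γφα⁻¹` and `φ₂ = δφβ⁻¹`. Setting `y = 1` or `x = 1` gives
the formulas for the components.

An autotopy is a similitude, because `n(φ(1))⁻¹ n∘φ` is again a Hurwitz norm and the multiplication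
determines the norm. Conversely, write a similitude as `φ = L_{φ(1)} σ`, where the isometry `σ`
fixes 1. In even dimension `σ` is a product of reflections (`isometry_induction`). The Moufang
identities make every invertible `L_a` and `R_a` an autotopy. A reflection is `-n(s)⁻¹ R_s L_s`
composed with the canonical involution, which normalizes the autotopies. Hence `φ` times the `i`-th
power of the involution is an autotopy, `i` being the number of reflections.

If `dim A ≤ 2`, the algebra is commutative and the involution is itself an autotopy. If `dim A ≥ 4`,
it is not, so `φ` is an autotopy exactly when `i` is even. Reflections are improper and left
multiplications are proper, so this is the condition that `φ` be proper. Properness of `L_a` follows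
from its characteristic polynomial when `char k ≠ 2`, and from an explicit Dickson invariant when
`char k = 2`. -/

theorem map_add_eq (n : QuadraticForm k V) (x y : V) : n (x + y) = n x + n y + polar n x y := by
  simp [polar]

theorem map_sub_eq (n : QuadraticForm k V) (x y : V) : n (x - y) = n x + n y - polar n x y := by
  rw [sub_eq_add_neg, map_add_eq, QuadraticMap.map_neg, QuadraticMap.polar_neg_right]; ring

theorem map_smul_eq (n : QuadraticForm k V) (c : k) (x : V) : n (c • x) = c ^ 2 * n x := by
  rw [QuadraticMap.map_smul, smul_eq_mul, sq]

theorem polar_self_eq (n : QuadraticForm k V) (x : V) : polar n x x = 2 * n x := by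
  rw [QuadraticMap.polar_self, two_nsmul, two_mul]

/-- Two vectors with the same polar products are equal. -/
theorem ext_polar (hn : ∀ x, (∀ y, polar n x y = 0) → x = 0) {x y : V}
    (h : ∀ z, polar n x z = polar n y z) : x = y := by
  rw [← sub_eq_zero]
  refine hn _ fun z => ?_
  rw [QuadraticMap.polar_sub_left, h, sub_self]

theorem polarBilin_isSymm (n : QuadraticForm k V) : n.polarBilin.IsSymm :=
  ⟨fun x y => QuadraticMap.polar_comm n x y⟩

theorem polarBilin_nondegenerate (hn : ∀ x, (∀ y, polar n x y = 0) → x = 0) :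
    n.polarBilin.Nondegenerate := by
  refine ⟨fun x h => hn x h, fun x h => hn x fun y => ?_⟩
  rw [QuadraticMap.polar_comm]; exact h y

theorem exists_polar_eq [FiniteDimensional k V] (hn : ∀ x, (∀ y, polar n x y = 0) → x = 0)
    (f : Module.Dual k V) : ∃ u, ∀ y, polar n u y = f y :=
  ⟨(LinearMap.BilinForm.toDual n.polarBilin (polarBilin_nondegenerate hn)).symm f, fun y =>
    LinearMap.BilinForm.apply_toDual_symm_apply (B := n.polarBilin)
      (hB := polarBilin_nondegenerate hn) f y⟩

/-- A bilinear form is represented by an endomorphism through a non-degenerate polar form. -/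
theorem exists_endomorphism_polar_eq [FiniteDimensional k V]
    (hn : ∀ x, (∀ y, polar n x y = 0) → x = 0) (r : LinearMap.BilinForm k V) :
    ∃ T : Module.End k V, ∀ x y, polar n (T x) y = r x y :=
  ⟨(LinearMap.BilinForm.toDual n.polarBilin (polarBilin_nondegenerate hn)).symm.toLinearMap ∘ₗ r,
    fun x y =>
    LinearMap.BilinForm.apply_toDual_symm_apply (B := n.polarBilin)
      (hB := polarBilin_nondegenerate hn) (r x) y⟩

theorem HasMultiplier.polar_eq {φ : V ≃ₗ[k] V} {μ : k} (h : HasMultiplier n φ μ) (x y : V) :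
    polar n (φ x) (φ y) = μ * polar n x y := by
  unfold polar
  rw [← map_add, h, h, h]; ring

theorem HasMultiplier.mul {φ ψ : V ≃ₗ[k] V} {μ ν : k} (h : HasMultiplier n φ μ)
    (h' : HasMultiplier n ψ ν) : HasMultiplier n (φ * ψ) (μ * ν) := fun x => by
  rw [LinearEquiv.mul_apply, h, h', mul_assoc]

theorem HasMultiplier.unique {φ : V ≃ₗ[k] V} {μ ν : k} {e : V} (he : n e ≠ 0)
    (h : HasMultiplier n φ μ) (h' : HasMultiplier n φ ν) : μ = ν :=
  mul_right_cancel₀ he ((h e).symm.trans (h' e))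

theorem HasMultiplier.ne_zero {φ : V ≃ₗ[k] V} {μ : k} {e : V} (he : n e ≠ 0)
    (h : HasMultiplier n φ μ) : μ ≠ 0 := by
  rintro rfl
  have := h (φ.symm e)
  simp at this
  exact he this

theorem HasMultiplier.inv {φ : V ≃ₗ[k] V} {μ : k} {e : V} (he : n e ≠ 0)
    (h : HasMultiplier n φ μ) : HasMultiplier n φ⁻¹ μ⁻¹ := fun x => by
  have h1 := h (φ⁻¹ x)
  have h2 : φ (φ⁻¹ x) = x := φ.apply_symm_apply x
  rw [h2] at h1
  rw [h1, inv_mul_cancel_left₀ (h.ne_zero he)]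

/-- The reflection in the hyperplane orthogonal to a nonsingular vector `s`. -/
noncomputable def reflect (n : QuadraticForm k V) (s : V) (hs : n s ≠ 0) : V ≃ₗ[k] V :=
  LinearEquiv.ofInvolutive (LinearMap.id - ((n s)⁻¹ • n.polarBilin.flip s).smulRight s) (by
    intro x
    have h : polar n s s = 2 * n s := polar_self_eq n s
    simp only [LinearMap.sub_apply, LinearMap.id_apply, LinearMap.smulRight_apply,
      LinearMap.smul_apply, LinearMap.flip_apply, QuadraticMap.polarBilin_apply_apply,
      smul_eq_mul, QuadraticMap.polar_sub_left, QuadraticMap.polar_smul_left, h]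
    match_scalars
    · ring
    · field_simp
      ring)

theorem reflect_apply (s : V) (hs : n s ≠ 0) (x : V) :
    reflect n s hs x = x - ((n s)⁻¹ * polar n x s) • s := rfl

theorem reflect_mul_self (s : V) (hs : n s ≠ 0) : reflect n s hs * reflect n s hs = 1 :=
  LinearEquiv.ext fun x => (reflect n s hs).left_inv x

theorem hasMultiplier_reflect (s : V) (hs : n s ≠ 0) : HasMultiplier n (reflect n s hs) 1 := by
  intro x
  rw [reflect_apply, map_sub_eq, map_smul_eq, QuadraticMap.polar_smul_right, smul_eq_mul]
  field_simp
  ring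

theorem reflect_of_polar_eq_zero {s : V} (hs : n s ≠ 0) {x : V} (hx : polar n x s = 0) :
    reflect n s hs x = x := by
  rw [reflect_apply, hx]; simp

theorem det_reflect [FiniteDimensional k V] (s : V) (hs : n s ≠ 0) :
    LinearMap.det (reflect n s hs : V →ₗ[k] V) = -1 := by
  have h : (reflect n s hs : V →ₗ[k] V) =
      LinearMap.transvection (-((n s)⁻¹ • n.polarBilin.flip s)) s := by
    ext x
    simp [reflect_apply, LinearMap.transvection, sub_eq_add_neg]
  rw [h, LinearMap.transvection.det]
  simp only [LinearMap.neg_apply, LinearMap.smul_apply, LinearMap.flip_apply,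
    QuadraticMap.polarBilin_apply_apply, polar_self_eq, smul_eq_mul]
  field_simp
  norm_num

/-- The fixed space of a linear automorphism. -/
def fixed (σ : V ≃ₗ[k] V) : Submodule k V := LinearMap.ker ((σ : V →ₗ[k] V) - 1)

theorem mem_fixed {σ : V ≃ₗ[k] V} {x : V} : x ∈ fixed σ ↔ σ x = x := by
  simp [fixed, sub_eq_zero]

/-- The residual space of an isometry is orthogonal to its fixed space. -/
theorem polar_sub_of_fixed {σ : V ≃ₗ[k] V} (hσ : HasMultiplier n σ 1) {x y : V} (hx : σ x = x) :
    polar n x (σ y - y) = 0 := by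
  have h := hσ.polar_eq x y
  rw [hx, one_mul] at h
  rw [QuadraticMap.polar_sub_right, h, sub_self]

theorem map_sub_self_eq {σ : V ≃ₗ[k] V} (hσ : HasMultiplier n σ 1) (x : V) :
    n (σ x - x) = - polar n x (σ x - x) := by
  rw [map_sub_eq, hσ x, QuadraticMap.polar_sub_right, polar_self_eq, QuadraticMap.polar_comm]; ring

/-- If `σ x - x` is nonsingular, a reflection enlarges the fixed space of the isometry `σ`. -/
theorem exists_fixed_lt_of_nonsingular {σ : V ≃ₗ[k] V} (hσ : HasMultiplier n σ 1) {x : V}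
    (hx : n (σ x - x) ≠ 0) : fixed σ < fixed (reflect n (σ x - x) hx * σ) := by
  -- This value makes the reflection in `σ x - x` carry `σ x` back to `x`.
  have hsx : polar n (σ x) (σ x - x) = n (σ x - x) := by
    have h1 := map_sub_self_eq hσ x
    have h2 := polar_self_eq n (σ x - x)
    rw [QuadraticMap.polar_sub_left] at h2
    linear_combination h2 + h1
  refine lt_of_le_of_ne (fun y hy => ?_) fun h => ?_
  · rw [mem_fixed] at hy ⊢
    rw [LinearEquiv.mul_apply, hy, reflect_of_polar_eq_zero hx (polar_sub_of_fixed hσ hy)]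
  · have : x ∈ fixed (reflect n (σ x - x) hx * σ) := by
      rw [mem_fixed, LinearEquiv.mul_apply, reflect_apply, hsx, inv_mul_cancel₀ hx]
      simp
    rw [← h, mem_fixed] at this
    rw [this] at hx
    simp at hx

/-- Two proper subspaces do not cover the space. -/
theorem exists_notMem_of_ne_top {p q : Submodule k V} (hp : p ≠ ⊤) (hq : q ≠ ⊤) :
    ∃ y, y ∉ p ∧ y ∉ q := by
  obtain ⟨y, hy⟩ := SetLike.exists_not_mem_of_ne_top p hp rfl
  obtain ⟨z, hz⟩ := SetLike.exists_not_mem_of_ne_top q hq rfl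
  by_cases h1 : y ∈ q
  · by_cases h2 : z ∈ p
    · exact ⟨y + z, fun h => hy ((p.add_mem_iff_left h2).1 h), fun h => hz
        ((q.add_mem_iff_right h1).1 h)⟩
    · exact ⟨z, h2, hz⟩
  · exact ⟨y, hy, h1⟩

/-- A totally singular subspace is contained in its orthogonal complement. -/
theorem le_orthogonal_of_singular {W : Submodule k V} (hW : ∀ x ∈ W, n x = 0) :
    W ≤ LinearMap.BilinForm.orthogonal n.polarBilin W := by
  intro x hx
  rw [LinearMap.BilinForm.mem_orthogonal_iff]
  intro y hy
  change polar n y x = 0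
  rw [polar, hW _ (W.add_mem hy hx), hW _ hy, hW _ hx]; simp

section FiniteDimensional

variable [FiniteDimensional k V]

theorem finrank_orthogonal_add (hn : ∀ x, (∀ y, polar n x y = 0) → x = 0) (W : Submodule k V) :
    finrank k (LinearMap.BilinForm.orthogonal n.polarBilin W) + finrank k W = finrank k V := by
  rw [LinearMap.BilinForm.finrank_orthogonal (polarBilin_nondegenerate hn)]
  exact Nat.sub_add_cancel W.finrank_le

theorem orthogonal_orthogonal_eq (hn : ∀ x, (∀ y, polar n x y = 0) → x = 0)
    (W : Submodule k V) : LinearMap.BilinForm.orthogonal n.polarBilin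
      (LinearMap.BilinForm.orthogonal n.polarBilin W) = W :=
  LinearMap.BilinForm.orthogonal_orthogonal (polarBilin_nondegenerate hn)
    (polarBilin_isSymm n).isRefl W

/-- If the residual space of an isometry `σ` fixing a nonsingular vector `e` is totally singular,
then `σ` fixes a nonsingular vector orthogonal to `e`. -/
theorem exists_nonsingular_fixed (hn : ∀ x, (∀ y, polar n x y = 0) → x = 0)
    (hd : Even (finrank k V)) {e : V} (he : n e ≠ 0) {σ : V ≃ₗ[k] V} (hσ : HasMultiplier n σ 1)
    (hσe : σ e = e) (hS : ∀ x, n (σ x - x) = 0) :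
    ∃ a, σ a = a ∧ polar n a e = 0 ∧ n a ≠ 0 := by
  by_contra! hcon
  set S : Submodule k V := LinearMap.range ((σ : V →ₗ[k] V) - 1) with hSdef
  have hsum : finrank k S + finrank k (fixed σ) = finrank k V :=
    LinearMap.finrank_range_add_finrank_ker _
  have hSsing : ∀ x ∈ S, n x = 0 := by
    rintro _ ⟨x, rfl⟩
    exact hS x
  have hF : fixed σ = LinearMap.BilinForm.orthogonal n.polarBilin S := by
    refine Submodule.eq_of_le_of_finrank_eq ?_ ?_
    · intro x hx
      rw [LinearMap.BilinForm.mem_orthogonal_iff]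
      rintro _ ⟨y, rfl⟩
      change polar n (σ y - y) x = 0
      rw [QuadraticMap.polar_comm]
      exact polar_sub_of_fixed hσ (mem_fixed.1 hx)
    · have := finrank_orthogonal_add hn S
      omega
  have heF : e ∈ fixed σ := mem_fixed.2 hσe
  have heS : e ∉ S := fun h => he (hSsing e h)
  have hlt : finrank k S < finrank k (fixed σ) := by
    refine Submodule.finrank_lt_finrank_of_lt (lt_of_le_of_ne ?_ ?_)
    · rw [hF]; exact le_orthogonal_of_singular hSsing
    · rintro h
      rw [← h] at heF
      exact heS heF
  set X : Submodule k V := S ⊔ Submodule.span k {e} with hX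
  have hXrank : finrank k X = finrank k S + 1 := by
    have h := Submodule.finrank_sup_add_finrank_inf_eq S (Submodule.span k {e})
    have h2 : S ⊓ Submodule.span k {e} = ⊥ := by
      rw [eq_bot_iff]
      rintro x ⟨hx, hxe⟩
      obtain ⟨c, rfl⟩ := Submodule.mem_span_singleton.1 hxe
      by_cases hc : c = 0
      · simp [hc]
      · exact absurd ((S.smul_mem_iff hc).1 hx) heS
    have hne : e ≠ 0 := by rintro rfl; simp at he
    rw [h2, finrank_bot, finrank_span_singleton hne] at h
    omega
  set W := LinearMap.BilinForm.orthogonal n.polarBilin X with hW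
  have hWsing : ∀ x ∈ W, n x = 0 := by
    intro x hx
    have h1 : x ∈ fixed σ := by
      rw [hF]
      exact LinearMap.BilinForm.orthogonal_le le_sup_left hx
    have h2 : polar n e x = 0 :=
      (LinearMap.BilinForm.mem_orthogonal_iff.1 hx) e
        (Submodule.mem_sup_right (Submodule.mem_span_singleton_self e))
    rw [QuadraticMap.polar_comm] at h2
    exact hcon x (mem_fixed.1 h1) h2
  have hWX : W ≤ X := by
    have := le_orthogonal_of_singular hWsing
    rwa [hW, orthogonal_orthogonal_eq hn, ← hW] at this
  have hWrank := finrank_orthogonal_add hn X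
  rw [← hW] at hWrank
  have hle := Submodule.finrank_mono hWX
  obtain ⟨m, hm⟩ := hd
  -- With `s = dim S`, `hlt` gives `2s < dim V` and `W ≤ X` gives `dim V ≤ 2s + 2`. Evenness forces
  -- equality, so the totally singular `W` would contain `e`.
  have hWeq : W = X := Submodule.eq_of_le_of_finrank_eq hWX (by omega)
  exact he (hWsing e (hWeq ▸ Submodule.mem_sup_right (Submodule.mem_span_singleton_self e)))

/-- A product of two reflections makes the residual space of an isometry `σ` not totally singular,
without decreasing the dimension of the fixed space. -/
theorem exists_reflect_mul_reflect (hn : ∀ x, (∀ y, polar n x y = 0) → x = 0)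
    (hd : Even (finrank k V)) {e : V} (he : n e ≠ 0) {σ : V ≃ₗ[k] V} (hσ : HasMultiplier n σ 1)
    (hσe : σ e = e) (hS : ∀ x, n (σ x - x) = 0) (hσ1 : σ ≠ 1) :
    ∃ (a s : V) (ha : n a ≠ 0) (hs : n s ≠ 0),
      polar n e a = 0 ∧ polar n e s = 0 ∧
      finrank k (fixed σ) ≤ finrank k (fixed (reflect n s hs * (reflect n a ha * σ))) ∧
      ∃ x, n ((reflect n s hs * (reflect n a ha * σ)) x - x) ≠ 0 := by
  obtain ⟨a, hσa, hae, ha⟩ := exists_nonsingular_fixed hn hd he hσ hσe hS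
  have hp : fixed σ ≠ ⊤ := fun h => hσ1 (LinearEquiv.ext fun x => mem_fixed.1 (h ▸ trivial))
  have hq : LinearMap.ker (n.polarBilin a) ≠ ⊤ := fun h => by
    have h0 : a = 0 := hn a fun y => by
      have : y ∈ LinearMap.ker (n.polarBilin a) := h ▸ trivial
      exact this
    rw [h0] at ha
    simp at ha
  obtain ⟨y, hy1, hy2⟩ := exists_notMem_of_ne_top hp hq
  rw [mem_fixed] at hy1
  replace hy2 : polar n a y ≠ 0 := hy2
  -- The product of the reflections in `a` and `a + c(σ y - y)` with `σ` sends `y` to `σ y +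
  -- n(a)⁻¹⟨a,y⟩c(σ y - y)`. This `c` makes that equal to `y`.
  obtain ⟨c, hc⟩ : ∃ c, c = -(n a / polar n a y) := ⟨_, rfl⟩
  have hc0 : c ≠ 0 := by rw [hc]; exact neg_ne_zero.2 (div_ne_zero ha hy2)
  have hcy : c * polar n a y = - n a := by rw [hc]; field_simp
  obtain ⟨s₀, hs₀⟩ : ∃ s₀, s₀ = c • (σ y - y) := ⟨_, rfl⟩
  have hs₀0 : s₀ ≠ 0 := by rw [hs₀]; exact smul_ne_zero hc0 (sub_ne_zero.2 hy1)
  have hfix : ∀ {x}, σ x = x → polar n x s₀ = 0 := fun hx => by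
    rw [hs₀, QuadraticMap.polar_smul_right, polar_sub_of_fixed hσ hx, smul_zero]
  have hsing : n s₀ = 0 := by rw [hs₀, map_smul_eq, hS, mul_zero]
  have has : polar n a s₀ = 0 := hfix hσa
  have hs' : n (a + s₀) = n a := by rw [map_add_eq, hsing, has]; ring
  have hs : n (a + s₀) ≠ 0 := by rwa [hs']
  have key : ∀ x, (reflect n (a + s₀) hs * (reflect n a ha * σ)) x = σ x
      - ((n a)⁻¹ * polar n (σ x) s₀) • a
      + ((n a)⁻¹ * (polar n (σ x) a - polar n (σ x) s₀)) • s₀ := by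
    intro x
    simp only [LinearEquiv.mul_apply, reflect_apply, hs', QuadraticMap.polar_add_right,
      QuadraticMap.polar_sub_left, QuadraticMap.polar_smul_left, has, polar_self_eq, smul_eq_mul]
    match_scalars <;> field_simp <;> ring
  have hres : ∀ x z, polar n (σ x - x) (σ z - z) = 0 := by
    intro x z
    have h := hS (x + z)
    have e1 : σ (x + z) - (x + z) = (σ x - x) + (σ z - z) := by rw [map_add]; abel
    rw [e1, map_add_eq, hS, hS] at h
    simpa using h
  have hσs : ∀ x, polar n (σ x) s₀ = polar n x s₀ := by
    intro x
    have := hres x y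
    rw [QuadraticMap.polar_sub_left, sub_eq_zero] at this
    rw [hs₀, QuadraticMap.polar_smul_right, QuadraticMap.polar_smul_right, this]
  have hσa' : ∀ x, polar n (σ x) a = polar n x a := by
    intro x
    have := hσ.polar_eq x a
    rwa [hσa, one_mul] at this
  refine ⟨a, a + s₀, ha, hs, by rwa [QuadraticMap.polar_comm], ?_, ?_, ?_⟩
  · rw [QuadraticMap.polar_add_right, QuadraticMap.polar_comm, hae, hfix hσe, add_zero]
  · have hyfix : y ∈ fixed (reflect n (a + s₀) hs * (reflect n a ha * σ)) := by
      have h1 : polar n y s₀ = 0 := by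
        have := map_sub_self_eq hσ y
        rw [hS, eq_comm, neg_eq_zero] at this
        rw [hs₀, QuadraticMap.polar_smul_right, this, smul_zero]
      rw [mem_fixed, key, hσs, hσa', h1, QuadraticMap.polar_comm, hs₀]
      have h2 : (n a)⁻¹ * (polar n a y - 0) * c = -1 := by
        field_simp
        linear_combination hcy
      rw [smul_smul, h2]
      simp
    -- The new fixed space loses at most one dimension, from `fixed σ` to its part orthogonal to
    -- `a`, and regains one from `y`, which `σ` moves.
    set F' := fixed σ ⊓ LinearMap.ker (n.polarBilin a) with hF'
    have hle : F' ≤ fixed (reflect n (a + s₀) hs * (reflect n a ha * σ)) := by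
      rintro x ⟨hx, hxa⟩
      rw [mem_fixed]
      have hx' := mem_fixed.1 hx
      replace hxa : polar n a x = 0 := hxa
      rw [key, hx', hfix hx', QuadraticMap.polar_comm, hxa]
      simp
    have hlt : F' < fixed (reflect n (a + s₀) hs * (reflect n a ha * σ)) := by
      refine lt_of_le_of_ne hle fun h => ?_
      rw [← h] at hyfix
      exact hy1 (mem_fixed.1 hyfix.1)
    have h1 := Submodule.finrank_lt_finrank_of_lt hlt
    have h2 := Submodule.finrank_sup_add_finrank_inf_eq (fixed σ) (LinearMap.ker (n.polarBilin a))
    rw [← hF'] at h2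
    have h3 := LinearMap.finrank_range_add_finrank_ker (n.polarBilin a)
    have h4 : finrank k (LinearMap.range (n.polarBilin a)) ≤ 1 :=
      (Submodule.finrank_le _).trans (Module.finrank_self k).le
    have h5 := Submodule.finrank_le (fixed σ ⊔ LinearMap.ker (n.polarBilin a))
    omega
  · obtain ⟨x, hx⟩ : ∃ x, polar n s₀ x ≠ 0 := by
      by_contra! h
      exact hs₀0 (hn s₀ h)
    rw [QuadraticMap.polar_comm] at hx
    refine ⟨x, ?_⟩
    obtain ⟨b, hb⟩ : ∃ b, b = (n a)⁻¹ * (polar n x a - polar n x s₀) := ⟨_, rfl⟩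
    have h1 : (reflect n (a + s₀) hs * (reflect n a ha * σ)) x - x =
        ((σ x - x) + b • s₀) - ((n a)⁻¹ * polar n x s₀) • a := by
      rw [key, hσs, hσa', hb]; abel
    have h2 : n ((σ x - x) + b • s₀) = 0 := by
      have : polar n (σ x - x) s₀ = 0 := by
        rw [hs₀, QuadraticMap.polar_smul_right, hres, smul_zero]
      rw [map_add_eq, hS, map_smul_eq, hsing, QuadraticMap.polar_smul_right, this]; simp
    have h3 : polar n ((σ x - x) + b • s₀) a = 0 := by
      rw [QuadraticMap.polar_add_left, QuadraticMap.polar_smul_left, QuadraticMap.polar_comm n s₀,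
        has, QuadraticMap.polar_comm, polar_sub_of_fixed hσ hσa]; simp
    rw [h1, map_sub_eq, h2, map_smul_eq, QuadraticMap.polar_smul_right, h3]
    simp [ha, hx]

/-- Isometries fixing a nonsingular vector of an even-dimensional non-degenerate quadratic space are
products of reflections. -/
theorem isometry_induction (hn : ∀ x, (∀ y, polar n x y = 0) → x = 0)
    (hd : Even (finrank k V)) {e : V} (he : n e ≠ 0) {C : (V ≃ₗ[k] V) → Prop} (h1 : C 1)
    (hmul : ∀ (s : V) (hs : n s ≠ 0) (σ : V ≃ₗ[k] V), C σ → C (reflect n s hs * σ))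
    {σ : V ≃ₗ[k] V} (hσ : HasMultiplier n σ 1) (hσe : σ e = e) : C σ := by
  have hC : ∀ (s : V) (hs : n s ≠ 0) (σ : V ≃ₗ[k] V), C (reflect n s hs * σ) → C σ := by
    intro s hs σ h
    simpa only [← mul_assoc, reflect_mul_self, one_mul] using hmul s hs _ h
  induction hm : finrank k V - finrank k (fixed σ) using Nat.strong_induction_on generalizing σ with
  | _ m ih =>
    -- One reflection lowers the codimension of the fixed space of such a `τ`. A `σ` with totally
    -- singular residual space is first multiplied by two reflections. All reflecting vectors are
    -- orthogonal to `e`, so `e` stays fixed.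
    have step : ∀ τ : V ≃ₗ[k] V, HasMultiplier n τ 1 → τ e = e →
        finrank k (fixed σ) ≤ finrank k (fixed τ) → (∃ x, n (τ x - x) ≠ 0) → C τ := by
      rintro τ hτ hτe hle ⟨x, hx⟩
      have hlt := Submodule.finrank_lt_finrank_of_lt (exists_fixed_lt_of_nonsingular hτ hx)
      have hfull := Submodule.finrank_le (fixed (reflect n (τ x - x) hx * τ))
      refine hC _ hx _ (ih _ ?_ (by simpa using (hasMultiplier_reflect _ hx).mul hτ) ?_ rfl)
      · omega
      · rw [LinearEquiv.mul_apply, hτe, reflect_of_polar_eq_zero hx (polar_sub_of_fixed hτ hτe)]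
    by_cases hσ1 : σ = 1
    · rwa [hσ1]
    by_cases hS : ∀ x, n (σ x - x) = 0
    · obtain ⟨a, s, ha, hs, hea, hes, hle, hx⟩ :=
        exists_reflect_mul_reflect hn hd he hσ hσe hS hσ1
      refine hC a ha _ (hC s hs _ (step _ ?_ ?_ hle hx))
      · simpa using (hasMultiplier_reflect s hs).mul ((hasMultiplier_reflect a ha).mul hσ)
      · rw [LinearEquiv.mul_apply, LinearEquiv.mul_apply, hσe, reflect_of_polar_eq_zero ha hea,
          reflect_of_polar_eq_zero hs hes]
    · push Not at hS
      exact step σ hσ hσe le_rfl hS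

end FiniteDimensional

end QuadraticSpace

/-! ### The Dickson invariant. -/

section Dickson

variable {k V : Type*} [Field k] [AddCommGroup V] [Module k V] [FiniteDimensional k V]
  {n : QuadraticForm k V}

theorem sum_sum_eq_zero_of_symm [CharP k 2] {ι : Type*} [Fintype ι] (f : ι → ι → k)
    (hf : ∀ i j, f i j = f j i) (h0 : ∀ i, f i i = 0) : ∑ i, ∑ j, f i j = 0 := by
  rw [← Finset.sum_product']
  refine Finset.sum_involution (fun p _ => p.swap) ?_ ?_ ?_ ?_
  · rintro ⟨i, j⟩ -
    change f i j + f j i = 0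
    rw [hf i j, CharTwo.add_self_eq_zero]
  · rintro ⟨i, j⟩ - h h'
    obtain rfl : j = i := congrArg Prod.fst h'
    exact h (h0 _)
  · intros; simp
  · intros; simp

/-- In characteristic two, an endomorphism that is symmetric for the polar form has trace zero. -/
theorem trace_eq_zero_of_polar_symm [CharP k 2] (hn : ∀ x, (∀ y, polar n x y = 0) → x = 0)
    {U : Module.End k V} (hU : ∀ x y, polar n (U x) y = polar n (U y) x) :
    LinearMap.trace k V U = 0 := by
  classical
  let b := Module.finBasis k V
  have hB := polarBilin_nondegenerate hn
  let c := LinearMap.BilinForm.dualBasis n.polarBilin hB b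
  have hc : ∀ x i, c.repr x i = polar n x (b i) := fun x i =>
    LinearMap.BilinForm.dualBasis_repr_apply hB b x i
  have hbc : ∀ i, b i = ∑ j, polar n (b i) (b j) • c j := fun i => by
    conv_lhs => rw [← c.sum_repr (b i)]
    simp only [hc]
  rw [LinearMap.trace_eq_matrix_trace k c, Matrix.trace]
  -- The trace is a sum of products of two symmetric factors. Its diagonal terms vanish since the
  -- polar form is alternating in characteristic two.
  have : ∀ i, (LinearMap.toMatrix c c U).diag i =
      ∑ j, polar n (b i) (b j) * polar n (U (c i)) (c j) := fun i => by
    rw [Matrix.diag_apply, LinearMap.toMatrix_apply, hc]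
    conv_lhs => rw [hbc i]
    change n.polarBilin _ _ = _
    simp [map_sum]
  rw [Finset.sum_congr rfl fun i _ => this i]
  refine sum_sum_eq_zero_of_symm _ (fun i j => ?_) fun i => ?_
  · rw [QuadraticMap.polar_comm n (b i), hU]
  · rw [polar_self_eq, CharTwo.two_eq_zero, zero_mul, zero_mul]

/-- An alternating form is the alternation of a bilinear form. -/
theorem exists_eq_sub_of_alternating (hn : ∀ x, (∀ y, polar n x y = 0) → x = 0)
    (C : LinearMap.BilinForm k V) (hC : ∀ x, C x x = 0) :
    ∃ S : Module.End k V, ∀ x y, C x y = polar n (S x) y - polar n (S y) x := by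
  classical
  let b := Module.finBasis k V
  let r : LinearMap.BilinForm k V :=
    b.constr k fun i => b.constr k fun j => if i < j then C (b i) (b j) else 0
  have hr : ∀ i j, r (b i) (b j) = if i < j then C (b i) (b j) else 0 := fun i j => by
    simp only [r, Module.Basis.constr_basis]
  obtain ⟨S, hS⟩ := exists_endomorphism_polar_eq hn r
  refine ⟨S, fun x y => ?_⟩
  rw [hS, hS]
  have : C = r - r.flip := by
    refine LinearMap.ext_basis b b fun i j => ?_
    change _ = r (b i) (b j) - r (b j) (b i)
    rw [hr, hr]
    have hneg : C (b i) (b j) = - C (b j) (b i) := by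
      have := hC (b i + b j)
      simp only [map_add, LinearMap.add_apply, hC] at this
      linear_combination this
    rcases lt_trichotomy i j with h | h | h
    · simp [h, h.not_gt]
    · subst h; simp [hC]
    · simp [h, h.not_gt, hneg]
  exact congrArg (fun f : LinearMap.BilinForm k V => f x y) this

/-- The Dickson invariant can be computed from any form `B` with `B x x = n x`. -/
theorem HasDicksonInvariant.exists_of_form (hn : ∀ x, (∀ y, polar n x y = 0) → x = 0)
    {e : V} (he : n e ≠ 0) {φ : V ≃ₗ[k] V} {d μ : k} (h : HasDicksonInvariant n φ d)
    (hμ : HasMultiplier n φ μ) {B : LinearMap.BilinForm k V} (hB : ∀ x, B x x = n x) :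
    ∃ T : Module.End k V, (∀ x y, B (φ x) (φ y) - μ * B x y =
      polar n (T x) y - polar n (T y) x) ∧ LinearMap.trace k V T = μ * d := by
  obtain ⟨μ', B', T, hμ', hB', hT, htr⟩ := h
  obtain rfl := hμ.unique he hμ'
  obtain ⟨S, hS⟩ := exists_eq_sub_of_alternating hn (B - B') fun x => by
    simp [hB, hB']
  -- Replacing `B'` by `B` changes `T` by `μ(φ⁻¹Sφ - S)`, which has trace zero.
  refine ⟨T + μ • ((φ.symm : V →ₗ[k] V) ∘ₗ S ∘ₗ (φ : V →ₗ[k] V) - S), fun x y => ?_, ?_⟩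
  · have h1 := hS (φ x) (φ y)
    have h2 := hS x y
    have h3 := hT x y
    have h4 : ∀ z w, polar n (S (φ z)) (φ w) = μ * polar n (φ.symm (S (φ z))) w := fun z w => by
      rw [← hμ.polar_eq, φ.apply_symm_apply]
    rw [h4, h4] at h1
    simp only [LinearMap.sub_apply] at h1 h2
    simp only [LinearMap.add_apply, LinearMap.smul_apply, LinearMap.sub_apply,
      LinearMap.comp_apply, LinearEquiv.coe_coe, QuadraticMap.polar_add_left,
      QuadraticMap.polar_smul_left, QuadraticMap.polar_sub_left, smul_eq_mul]
    linear_combination h1 - μ * h2 + h3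
  · have : LinearMap.trace k V ((φ.symm : V →ₗ[k] V) ∘ₗ S ∘ₗ (φ : V →ₗ[k] V)) =
        LinearMap.trace k V S := LinearMap.trace_conj' S φ.symm
    rw [map_add, map_smul, map_sub, this, sub_self, smul_zero, add_zero, htr]

/-- Once the form `B` is the same, two choices of `T` differ by an endomorphism symmetric for the
polar form, which has trace zero. -/
theorem HasDicksonInvariant.unique [CharP k 2] (hn : ∀ x, (∀ y, polar n x y = 0) → x = 0)
    {e : V} (he : n e ≠ 0) {φ : V ≃ₗ[k] V} {d d' : k} (h : HasDicksonInvariant n φ d)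
    (h' : HasDicksonInvariant n φ d') : d = d' := by
  obtain ⟨μ, B, T, hμ, hB, hT, htr⟩ := h
  obtain ⟨T', hT', htr'⟩ := h'.exists_of_form hn he hμ hB
  have := trace_eq_zero_of_polar_symm hn (U := T - T') fun x y => by
    simp only [LinearMap.sub_apply, QuadraticMap.polar_sub_left]
    linear_combination hT' x y - hT x y
  rw [map_sub, htr, htr', ← mul_sub, mul_eq_zero, sub_eq_zero] at this
  exact this.resolve_left (hμ.ne_zero he)

theorem HasDicksonInvariant.mul (hn : ∀ x, (∀ y, polar n x y = 0) → x = 0)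
    {e : V} (he : n e ≠ 0) {φ ψ : V ≃ₗ[k] V} {d d' : k} (h : HasDicksonInvariant n φ d)
    (h' : HasDicksonInvariant n ψ d') : HasDicksonInvariant n (φ * ψ) (d + d') := by
  obtain ⟨μ, B, T, hμ, hB, hT, htr⟩ := h
  have h'' := h'
  obtain ⟨ν, -, -, hν, -⟩ := h'
  obtain ⟨T', hT', htr'⟩ := h''.exists_of_form hn he hν hB
  refine ⟨μ * ν, B, ν • ((ψ.symm : V →ₗ[k] V) ∘ₗ T ∘ₗ (ψ : V →ₗ[k] V)) + μ • T', hμ.mul hν, hB,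
    fun x y => ?_, ?_⟩
  · have h1 := hT (ψ x) (ψ y)
    have h2 := hT' x y
    have h4 : ∀ z w, polar n (T (ψ z)) (ψ w) = ν * polar n (ψ.symm (T (ψ z))) w := fun z w => by
      rw [← hν.polar_eq, ψ.apply_symm_apply]
    rw [h4, h4] at h1
    simp only [LinearMap.add_apply, LinearMap.smul_apply, LinearEquiv.mul_apply,
      LinearMap.comp_apply, LinearEquiv.coe_coe, QuadraticMap.polar_add_left,
      QuadraticMap.polar_smul_left, smul_eq_mul]
    linear_combination h1 + μ * h2
  · have : LinearMap.trace k V ((ψ.symm : V →ₗ[k] V) ∘ₗ T ∘ₗ (ψ : V →ₗ[k] V)) =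
        LinearMap.trace k V T := LinearMap.trace_conj' T ψ.symm
    rw [map_add, map_smul, map_smul, this, htr, htr', smul_eq_mul, smul_eq_mul]
    ring

theorem hasDicksonInvariant_reflect (hn : ∀ x, (∀ y, polar n x y = 0) → x = 0) (s : V)
    (hs : n s ≠ 0) : HasDicksonInvariant n (reflect n s hs) (-1) := by
  obtain ⟨B, hB⟩ := LinearMap.BilinMap.toQuadraticMap_surjective (R := k) (M := V) (N := k) n
  have hB' : ∀ x, B x x = n x := fun x => by rw [← hB]; rfl
  have hpol : ∀ x y, polar n x y = B x y + B y x := fun x y => by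
    rw [← hB, LinearMap.BilinMap.polar_toQuadraticMap]
  -- The rank-one `T x = -n(s)⁻¹⟨s,x⟩ w` has trace `-n(s)⁻¹⟨s,w⟩ = -n(s)⁻¹ B(s,s) = -1`.
  obtain ⟨w, hw⟩ := exists_polar_eq hn (B s)
  refine ⟨1, B, (-(n s)⁻¹ • n.polarBilin s).smulRight w, hasMultiplier_reflect s hs, hB',
    fun x y => ?_, ?_⟩
  · simp only [reflect_apply, map_sub, map_smul, LinearMap.sub_apply, LinearMap.smul_apply,
      LinearMap.smulRight_apply, QuadraticMap.polar_smul_left, hw, hB', smul_eq_mul,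
      QuadraticMap.polarBilin_apply_apply]
    rw [hpol x s, hpol y s, hpol s x, hpol s y]
    field_simp
    ring
  · rw [LinearMap.trace_smulRight]
    simp only [LinearMap.smul_apply, QuadraticMap.polarBilin_apply_apply,
      QuadraticMap.polar_comm n s w, hw, hB', smul_eq_mul]
    field_simp

end Dickson

/-! ### Identities in a Hurwitz algebra. -/

section Hurwitz

variable {k A : Type*} [Field k] [NonAssocRing A] [Module k A] [IsScalarTower k A A]
  [SMulCommClass k A A] {n : QuadraticForm k A}

set_option linter.unusedSectionVars false

theorem IsHurwitz.norm_one (hA : IsHurwitz n) : n 1 = 1 := by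
  have h := hA.norm_mul 1 1
  rw [one_mul] at h
  by_contra h1
  have h0 : n 1 = 0 := by
    by_contra h0
    exact h1 (mul_left_cancel₀ h0 (by rw [← h, mul_one]))
  have hz : ∀ x, n x = 0 := fun x => by rw [← one_mul x, hA.norm_mul, h0, zero_mul]
  have := hA.nontrivial
  exact one_ne_zero (hA.nondegenerate 1 fun y => by simp [polar, hz])

theorem IsHurwitz.norm_one_ne_zero (hA : IsHurwitz n) : n 1 ≠ 0 := by
  rw [hA.norm_one]; exact one_ne_zero

theorem IsHurwitz.polar_mul_left (hA : IsHurwitz n) (x y z : A) :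
    polar n (x * y) (x * z) = n x * polar n y z := by
  simp only [polar, ← mul_add, hA.norm_mul]; ring

/-- The composition law linearized in both factors; the adjoints of the multiplications and the
Moufang identities are specializations. -/
theorem IsHurwitz.polar_mul_mul (hA : IsHurwitz n) (x y z w : A) :
    polar n (x * y) (z * w) + polar n (z * y) (x * w) = polar n x z * polar n y w := by
  have h := hA.polar_mul_left (x + z) y w
  rw [add_mul, add_mul, QuadraticMap.polar_add_left, QuadraticMap.polar_add_right,
    QuadraticMap.polar_add_right, hA.polar_mul_left, hA.polar_mul_left, map_add_eq] at h
  linear_combination h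

/-- The canonical involution `x ↦ ⟨x, 1⟩ 1 - x`. -/
def conj (n : QuadraticForm k A) (x : A) : A := polar n x 1 • (1 : A) - x

theorem IsHurwitz.polar_mul_eq_left (hA : IsHurwitz n) (x y z : A) :
    polar n (x * y) z = polar n y (conj n x * z) := by
  have h := hA.polar_mul_mul x y 1 z
  rw [one_mul, one_mul] at h
  rw [conj, sub_mul, smul_mul_assoc, one_mul, QuadraticMap.polar_sub_right,
    QuadraticMap.polar_smul_right, smul_eq_mul]
  linear_combination h

theorem IsHurwitz.polar_mul_eq_right (hA : IsHurwitz n) (x y z : A) :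
    polar n (y * x) z = polar n y (z * conj n x) := by
  have h := hA.polar_mul_mul y x z 1
  rw [mul_one, mul_one, QuadraticMap.polar_comm n (z * x)] at h
  rw [conj, mul_sub, mul_smul_comm, mul_one, QuadraticMap.polar_sub_right,
    QuadraticMap.polar_smul_right, smul_eq_mul]
  linear_combination h

theorem IsHurwitz.polar_one_one (hA : IsHurwitz n) : polar n (1 : A) 1 = 2 := by
  rw [polar_self_eq, hA.norm_one, mul_one]

theorem IsHurwitz.conj_conj (hA : IsHurwitz n) (x : A) : conj n (conj n x) = x := by
  simp only [conj, QuadraticMap.polar_sub_left, QuadraticMap.polar_smul_left, hA.polar_one_one,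
    smul_eq_mul]
  module

theorem IsHurwitz.norm_conj (hA : IsHurwitz n) (x : A) : n (conj n x) = n x := by
  rw [conj, map_sub_eq, map_smul_eq, hA.norm_one, QuadraticMap.polar_smul_left,
    QuadraticMap.polar_comm n 1, smul_eq_mul]
  ring

theorem conj_add (n : QuadraticForm k A) (x y : A) : conj n (x + y) = conj n x + conj n y := by
  simp only [conj, QuadraticMap.polar_add_left]; module

theorem conj_smul (n : QuadraticForm k A) (c : k) (x : A) : conj n (c • x) = c • conj n x := by
  simp only [conj, QuadraticMap.polar_smul_left, smul_eq_mul]; module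

theorem IsHurwitz.conj_one (hA : IsHurwitz n) : conj n (1 : A) = 1 := by
  rw [conj, hA.polar_one_one]; module

theorem IsHurwitz.conj_mul_mul (hA : IsHurwitz n) (x y : A) : conj n x * (x * y) = n x • y :=
  ext_polar hA.nondegenerate fun z => by
    rw [QuadraticMap.polar_comm, ← hA.polar_mul_eq_left, hA.polar_mul_left,
      QuadraticMap.polar_smul_left, smul_eq_mul, QuadraticMap.polar_comm]

theorem IsHurwitz.mul_conj_mul (hA : IsHurwitz n) (x y : A) : x * (conj n x * y) = n x • y := by
  have := hA.conj_mul_mul (conj n x) y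
  rwa [hA.conj_conj, hA.norm_conj] at this

theorem IsHurwitz.polar_mul_right (hA : IsHurwitz n) (x y z : A) :
    polar n (y * x) (z * x) = n x * polar n y z := by
  simp only [polar, ← add_mul, hA.norm_mul]; ring

theorem IsHurwitz.mul_mul_conj (hA : IsHurwitz n) (x y : A) : (y * x) * conj n x = n x • y :=
  ext_polar hA.nondegenerate fun z => by
    rw [QuadraticMap.polar_comm, ← hA.polar_mul_eq_right, hA.polar_mul_right,
      QuadraticMap.polar_smul_left, smul_eq_mul, QuadraticMap.polar_comm]

theorem IsHurwitz.mul_conj_mul_self (hA : IsHurwitz n) (x y : A) :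
    (y * conj n x) * x = n x • y := by
  have := hA.mul_mul_conj (conj n x) y
  rwa [hA.conj_conj, hA.norm_conj] at this

theorem IsHurwitz.mul_conj (hA : IsHurwitz n) (x : A) : x * conj n x = n x • (1 : A) := by
  simpa using hA.mul_conj_mul x 1

theorem IsHurwitz.conj_mul (hA : IsHurwitz n) (x y : A) :
    conj n (x * y) = conj n y * conj n x := by
  have htr : ∀ x w : A, polar n (conj n x) w = polar n (x * w) 1 := fun x w => by
    rw [hA.polar_mul_eq_left, mul_one, QuadraticMap.polar_comm]
  refine ext_polar hA.nondegenerate fun z => ?_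
  rw [htr, hA.polar_mul_eq_left (conj n y), hA.conj_conj, htr, hA.polar_mul_eq_right z, one_mul,
    hA.polar_mul_eq_left x, hA.polar_mul_eq_left x, mul_one, hA.polar_mul_eq_right z]

/-- Every element of a Hurwitz algebra is a root of its rank polynomial. -/
theorem IsHurwitz.mul_self_eq (hA : IsHurwitz n) (x : A) :
    x * x = polar n x 1 • x - n x • (1 : A) := by
  rw [← hA.mul_conj, conj, mul_sub, mul_smul_comm, mul_one]; abel

theorem IsHurwitz.mul_mul_left_eq (hA : IsHurwitz n) (x z : A) :
    x * (x * z) = polar n x 1 • (x * z) - n x • z := by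
  rw [← hA.conj_mul_mul, conj, sub_mul, smul_mul_assoc, one_mul]; abel

theorem IsHurwitz.mul_mul_add_mul_mul (hA : IsHurwitz n) (x y z : A) :
    x * (y * z) + y * (x * z) =
      polar n x 1 • (y * z) + polar n y 1 • (x * z) - polar n x y • z := by
  have h := hA.mul_mul_left_eq (x + y) z
  simp only [add_mul, mul_add, QuadraticMap.polar_add_left, map_add_eq, add_smul, smul_add,
    hA.mul_mul_left_eq] at h
  rw [← sub_eq_zero] at h ⊢
  rw [← h]
  abel

theorem IsHurwitz.mul_add_mul (hA : IsHurwitz n) (x y : A) :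
    x * y + y * x = polar n x 1 • y + polar n y 1 • x - polar n x y • (1 : A) := by
  simpa using hA.mul_mul_add_mul_mul x y 1

theorem IsHurwitz.mul_conj_add_mul_conj (hA : IsHurwitz n) (x y : A) :
    x * conj n y + y * conj n x = polar n x y • (1 : A) := by
  have h := hA.mul_conj (x + y)
  simp only [conj_add, add_mul, mul_add, hA.mul_conj, map_add_eq, add_smul] at h
  rw [← sub_eq_zero] at h ⊢
  rw [← h]
  abel

theorem IsHurwitz.mul_mul_self (hA : IsHurwitz n) (s w : A) :
    (s * w) * s = polar n s (conj n w) • s - n s • conj n w := by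
  have h := hA.mul_conj_add_mul_conj s (conj n w)
  rw [hA.conj_conj] at h
  rw [eq_sub_of_add_eq h, sub_mul, smul_mul_assoc, one_mul, hA.mul_conj_mul_self]

theorem polar_conj_left (n : QuadraticForm k A) (x y : A) :
    polar n (conj n x) y = polar n x (conj n y) := by
  simp only [conj, QuadraticMap.polar_sub_left, QuadraticMap.polar_smul_left,
    QuadraticMap.polar_sub_right, QuadraticMap.polar_smul_right, smul_eq_mul,
    QuadraticMap.polar_comm n 1 y]
  ring

/-- The middle Moufang identity. -/
theorem IsHurwitz.moufang_middle (hA : IsHurwitz n) (a x y : A) :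
    (a * x) * (y * a) = (a * (x * y)) * a := by
  refine ext_polar hA.nondegenerate fun z => ?_
  -- Moving `a * x` across the form turns the left side into the first term of this identity. The
  -- right side is expanded by `mul_mul_self`.
  have h := hA.polar_mul_mul y a (conj n (a * x)) z
  rw [hA.mul_mul_self, hA.polar_mul_eq_left]
  simp only [QuadraticMap.polar_sub_left, QuadraticMap.polar_smul_left, smul_eq_mul]
  have h1 : polar n y (conj n (a * x)) = polar n a (conj n (x * y)) := by
    rw [hA.conj_mul, ← hA.polar_mul_eq_left, QuadraticMap.polar_comm, polar_conj_left]
  have h2 : polar n (conj n (a * x) * a) (y * z) = n a * polar n (conj n (x * y)) z := by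
    rw [hA.conj_mul, hA.mul_conj_mul_self, QuadraticMap.polar_smul_left, smul_eq_mul, hA.conj_mul,
      hA.polar_mul_eq_left (conj n y), hA.conj_conj]
  rw [h1, h2] at h
  linear_combination h

/-- The left Moufang identity. -/
theorem IsHurwitz.moufang_left (hA : IsHurwitz n) (a x y : A) :
    a * (x * (a * y)) = ((a * x) * a) * y := by
  refine ext_polar hA.nondegenerate fun z => ?_
  have h := hA.polar_mul_mul x (a * y) (conj n a) z
  rw [hA.conj_mul_mul, ← polar_conj_left] at h
  rw [hA.mul_mul_self, hA.polar_mul_eq_left a]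
  simp only [sub_mul, smul_mul_assoc, QuadraticMap.polar_sub_left, QuadraticMap.polar_smul_left,
    smul_eq_mul, hA.polar_mul_eq_left (conj n x), hA.conj_conj] at h ⊢
  rw [QuadraticMap.polar_comm n a]
  linear_combination h

/-- The right Moufang identity. -/
theorem IsHurwitz.moufang_right (hA : IsHurwitz n) (a x y : A) :
    ((y * a) * x) * a = y * ((a * x) * a) := by
  have h := congrArg (conj n) (hA.moufang_left (conj n a) (conj n x) (conj n y))
  simp only [hA.conj_mul, hA.conj_conj] at h
  rw [h]
  congr 1
  -- Conjugating the left identity leaves only flexibility, `a(xa) = (ax)a`.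
  simpa using hA.moufang_middle a 1 x

end Hurwitz

/-! ### Characteristic polynomials of adjoint endomorphisms. -/

section Adjoint

open Polynomial (X C)

variable {k V : Type*} [Field k] [AddCommGroup V] [Module k V] [FiniteDimensional k V]
  {n : QuadraticForm k V}

/-- The matrix of `f` in a basis is the transpose of the matrix of `g` in the dual basis. -/
theorem charpoly_eq_of_adjoint (hn : ∀ x, (∀ y, polar n x y = 0) → x = 0)
    {f g : Module.End k V} (h : ∀ x y, polar n (f x) y = polar n x (g y)) :
    f.charpoly = g.charpoly := by
  classical
  let b := Module.finBasis k V
  have hB := polarBilin_nondegenerate hn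
  let c := LinearMap.BilinForm.dualBasis n.polarBilin hB b
  have hc : ∀ x i, c.repr x i = polar n x (b i) := fun x i =>
    LinearMap.BilinForm.dualBasis_repr_apply hB b x i
  have hcb : ∀ i j, polar n (c i) (b j) = if j = i then 1 else 0 := fun i j =>
    LinearMap.BilinForm.apply_dualBasis_left hB b i j
  rw [← LinearMap.charpoly_toMatrix f b, ← LinearMap.charpoly_toMatrix g c,
    ← Matrix.charpoly_transpose]
  congr 1
  ext i j
  rw [Matrix.transpose_apply, LinearMap.toMatrix_apply, LinearMap.toMatrix_apply, hc,
    QuadraticMap.polar_comm, ← h, QuadraticMap.polar_comm]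
  have hx : ∀ x, polar n (c j) x = b.repr x j := fun x => by
    conv_lhs => rw [← b.sum_repr x]
    change n.polarBilin _ _ = _
    rw [map_sum]
    simp only [map_smul, QuadraticMap.polarBilin_apply_apply, hcb]
    simp
  rw [hx]

/-- Take determinants in `(X - f)(X - g) = X² - tX + c`. -/
theorem charpoly_sq_eq {f g : Module.End k V} {t c : k} (hadd : f + g = t • 1)
    (hmul : f * g = c • 1) (h : f.charpoly = g.charpoly) :
    f.charpoly ^ 2 = (X ^ 2 - C t * X + C c) ^ finrank k V := by
  classical
  let b := Module.finBasis k V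
  let F := (LinearMap.toMatrixAlgEquiv b f).map C
  let G := (LinearMap.toMatrixAlgEquiv b g).map C
  have hF : F + G = C t • 1 := by
    have := congrArg (fun M => (C : k →+* Polynomial k).mapMatrix (LinearMap.toMatrixAlgEquiv b M))
      hadd
    simp only [map_add, map_smul, map_one] at this
    change F + G = _ at this
    rw [this]
    ext i j : 2
    simp [Matrix.one_apply, Matrix.map_apply, apply_ite]
  have hFG : F * G = C c • 1 := by
    have := congrArg (fun M => (C : k →+* Polynomial k).mapMatrix (LinearMap.toMatrixAlgEquiv b M))
      hmul
    simp only [map_mul, map_smul, map_one] at this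
    change F * G = _ at this
    rw [this]
    ext i j : 2
    simp [Matrix.one_apply, Matrix.map_apply, apply_ite]
  have hf : f.charpoly = ((X : Polynomial k) • (1 : Matrix _ _ _) - F).det := by
    rw [← LinearMap.charpoly_toMatrix f b, Matrix.charpoly, Matrix.charmatrix,
      Matrix.scalar_apply, Matrix.smul_one_eq_diagonal]
    rfl
  have hg : g.charpoly = ((X : Polynomial k) • (1 : Matrix _ _ _) - G).det := by
    rw [← LinearMap.charpoly_toMatrix g b, Matrix.charpoly, Matrix.charmatrix,
      Matrix.scalar_apply, Matrix.smul_one_eq_diagonal]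
    rfl
  have hprod : ((X : Polynomial k) • 1 - F) * ((X : Polynomial k) • 1 - G) =
      (X ^ 2 - C t * X + C c : Polynomial k) • 1 := by
    have : ((X : Polynomial k) • 1 - F) * ((X : Polynomial k) • 1 - G) =
        (X ^ 2 : Polynomial k) • 1 - (X : Polynomial k) • (F + G) + F * G := by
      simp only [sub_mul, mul_sub, smul_mul_assoc, mul_smul_comm, one_mul, mul_one]
      module
    rw [this, hF, hFG]
    module
  rw [sq]
  nth_rewrite 2 [h]
  rw [hf, hg, ← Matrix.det_mul, hprod, Matrix.det_smul, Matrix.det_one, mul_one, Fintype.card_fin]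

theorem charpoly_eq_pow {f : Module.End k V} {t c : k}
    (hd : Even (finrank k V))
    (h : f.charpoly ^ 2 = (X ^ 2 - C t * X + C c) ^ finrank k V) :
    f.charpoly = (X ^ 2 - C t * X + C c) ^ (finrank k V / 2) := by
  have hP : (X ^ 2 - C t * X + C c : Polynomial k).Monic := by monicity!
  have hpow := hP.pow (finrank k V / 2)
  have hf := f.charpoly_monic
  obtain ⟨m, hm⟩ := hd
  have h2 : f.charpoly ^ 2 = ((X ^ 2 - C t * X + C c) ^ (finrank k V / 2)) ^ 2 := by
    rw [h, ← pow_mul]; congr 1; omega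
  rcases sq_eq_sq_iff_eq_or_eq_neg.1 h2 with h3 | h3
  · exact h3
  · have h4 := congrArg Polynomial.leadingCoeff h3
    rw [Polynomial.leadingCoeff_neg, hpow.leadingCoeff, hf.leadingCoeff] at h4
    rw [h3]
    have h5 : (-1 : Polynomial k) = 1 := by
      have := congrArg C h4
      simpa using this.symm
    rw [← neg_one_mul, h5, one_mul]

theorem even_of_sq_eq_pow {p q : Polynomial k} (hp : Squarefree p) (hu : ¬ IsUnit p) {d : ℕ}
    (h : q ^ 2 = p ^ d) : Even d := by
  by_contra hd
  obtain ⟨m, rfl⟩ := Nat.not_even_iff_odd.1 hd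
  have hdvd : p ^ m ∣ q := by
    rw [← IsIntegrallyClosed.pow_dvd_pow_iff two_ne_zero, h, ← pow_mul]
    exact pow_dvd_pow _ (by omega)
  obtain ⟨r, rfl⟩ := hdvd
  have hr : r * r = p := by
    have h0 : (p ^ m) ^ 2 ≠ 0 := pow_ne_zero _ (pow_ne_zero _ hp.ne_zero)
    refine mul_left_cancel₀ h0 ?_
    linear_combination h
  exact hu (hr ▸ (hp r (by rw [hr])).mul (hp r (by rw [hr])))

end Adjoint

/-! ### Left multiplications and the parity of the dimension. -/

section Hurwitz

open Polynomial (X C)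

variable {k A : Type*} [Field k] [NonAssocRing A] [Module k A] [IsScalarTower k A A]
  [SMulCommClass k A A] {n : QuadraticForm k A}

set_option linter.unusedSectionVars false

theorem IsHurwitz.charpoly_mulLeft_sq [FiniteDimensional k A] (hA : IsHurwitz n) (a : A) :
    (LinearMap.mulLeft k a).charpoly ^ 2 =
      (X ^ 2 - C (polar n a 1) * X + C (n a)) ^ finrank k A := by
  refine charpoly_sq_eq (g := LinearMap.mulLeft k (conj n a)) ?_ ?_ ?_
  · ext x
    simp [conj, sub_mul]
  · ext x
    exact hA.mul_conj_mul a x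
  · exact charpoly_eq_of_adjoint hA.nondegenerate fun x y => hA.polar_mul_eq_left a x y

/-- If the discriminant vanished identically, then in characteristic two 1 would be in the radical
of the polar form. Otherwise polarizing gives `⟨x,1⟩⟨y,1⟩ = 2⟨x,y⟩`, which puts every vector
orthogonal to 1 in the radical. -/
theorem IsHurwitz.exists_discr_ne_zero [FiniteDimensional k A] (hA : IsHurwitz n)
    (hd : 2 ≤ finrank k A) : ∃ a : A, polar n a 1 ^ 2 ≠ 4 * n a := by
  by_contra! h
  have hpol : ∀ x y : A, 2 * (polar n x 1 * polar n y 1) = 2 * (2 * polar n x y) := fun x y => by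
    have := h (x + y)
    rw [QuadraticMap.polar_add_left, map_add_eq] at this
    linear_combination this - h x - h y
  by_cases h2 : (2 : k) = 0
  · have := hA.nontrivial
    refine one_ne_zero (hA.nondegenerate (1 : A) fun y => ?_)
    have := h y
    rw [show (4 : k) = 2 * 2 by norm_num, h2, zero_mul, zero_mul] at this
    rw [QuadraticMap.polar_comm]
    exact pow_eq_zero_iff two_ne_zero |>.1 this
  · have h3 := LinearMap.finrank_range_add_finrank_ker (n.polarBilin (1 : A))
    have h4 : finrank k (LinearMap.range (n.polarBilin (1 : A))) ≤ 1 :=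
      (Submodule.finrank_le _).trans (Module.finrank_self k).le
    have h5 : LinearMap.ker (n.polarBilin (1 : A)) ≠ ⊥ := fun hb => by
      rw [hb, finrank_bot] at h3
      omega
    obtain ⟨a, ha, ha0⟩ := Submodule.exists_mem_ne_zero_of_ne_bot h5
    replace ha : polar n a 1 = 0 := by rw [QuadraticMap.polar_comm]; exact ha
    refine ha0 (hA.nondegenerate a fun y => ?_)
    have := hpol a y
    rw [ha, zero_mul, mul_zero] at this
    simpa [h2] using this.symm

theorem IsHurwitz.even_finrank [FiniteDimensional k A] (hA : IsHurwitz n)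
    (hd : 2 ≤ finrank k A) : Even (finrank k A) := by
  obtain ⟨a, ha⟩ := hA.exists_discr_ne_zero hd
  refine even_of_sq_eq_pow ?_ ?_ (hA.charpoly_mulLeft_sq a)
  · refine Polynomial.Separable.squarefree ?_
    -- A Bézout relation: with `p` the rank polynomial and `D` its discriminant, `p'² - 4p = D`.
    refine ⟨C (-4 / (polar n a 1 ^ 2 - 4 * n a)), C ((polar n a 1 ^ 2 - 4 * n a)⁻¹) *
      (2 * X - C (polar n a 1)), ?_⟩
    have h0 : polar n a 1 ^ 2 - 4 * n a ≠ 0 := sub_ne_zero.2 ha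
    have h1 : C ((polar n a 1 ^ 2 - 4 * n a)⁻¹) * (C (polar n a 1) ^ 2 - 4 * C (n a)) = 1 := by
      rw [← Polynomial.C_1, ← inv_mul_cancel₀ h0]
      simp [← map_ofNat C 4]
    have h2 : (C (-4 / (polar n a 1 ^ 2 - 4 * n a)) : Polynomial k) =
        -4 * C ((polar n a 1 ^ 2 - 4 * n a)⁻¹) := by
      rw [div_eq_mul_inv]; simp [← map_ofNat C 4]
    rw [h2]
    simp
    linear_combination h1
  · intro h
    have := Polynomial.natDegree_eq_zero_of_isUnit h
    have h2 : (X ^ 2 - C (polar n a 1) * X + C (n a)).natDegree = 2 := by compute_degree!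
    omega

theorem IsHurwitz.charpoly_mulLeft [FiniteDimensional k A] (hA : IsHurwitz n)
    (hd : Even (finrank k A)) (a : A) : (LinearMap.mulLeft k a).charpoly =
      (X ^ 2 - C (polar n a 1) * X + C (n a)) ^ (finrank k A / 2) :=
  charpoly_eq_pow hd (hA.charpoly_mulLeft_sq a)

theorem IsHurwitz.det_mulLeft [FiniteDimensional k A] (hA : IsHurwitz n)
    (hd : Even (finrank k A)) (a : A) :
    LinearMap.det (LinearMap.mulLeft k a) = n a ^ (finrank k A / 2) := by
  rw [LinearMap.det_eq_sign_charpoly_coeff, hA.charpoly_mulLeft hd, hd.neg_one_pow, one_mul,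
    Polynomial.coeff_zero_eq_eval_zero]
  simp

theorem IsHurwitz.trace_mulLeft [FiniteDimensional k A] (hA : IsHurwitz n)
    (hd : Even (finrank k A)) (a : A) :
    LinearMap.trace k A (LinearMap.mulLeft k a) = (finrank k A / 2 : ℕ) * polar n a 1 := by
  have hP : (X ^ 2 - C (polar n a 1) * X + C (n a) : Polynomial k).Monic := by monicity!
  have h2 : (X ^ 2 - C (polar n a 1) * X + C (n a)).natDegree = 2 := by compute_degree!
  rw [LinearMap.trace_eq_matrix_trace k (Module.finBasis k A),
    Matrix.trace_eq_neg_charpoly_nextCoeff, LinearMap.charpoly_toMatrix, hA.charpoly_mulLeft hd,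
    hP.nextCoeff_pow, Polynomial.nextCoeff_of_natDegree_pos (by omega), h2]
  simp

end Hurwitz

/-! ### Autotopies and the canonical involution. -/

section Hurwitz

variable {k A : Type*} [Field k] [NonAssocRing A] [Module k A] [IsScalarTower k A A]
  [SMulCommClass k A A] {n : QuadraticForm k A}

set_option linter.unusedSectionVars false

/-- Left multiplication by an element of non-zero norm. -/
noncomputable def IsHurwitz.mulLeftEquiv (hA : IsHurwitz n) (a : A) (ha : n a ≠ 0) : A ≃ₗ[k] A :=
  LinearEquiv.ofLinearMap (LinearMap.mulLeft k a) ((n a)⁻¹ • LinearMap.mulLeft k (conj n a))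
    (by ext x; simp [hA.mul_conj_mul, ha]) (by ext x; simp [hA.conj_mul_mul, ha])

/-- Right multiplication by an element of non-zero norm. -/
noncomputable def IsHurwitz.mulRightEquiv (hA : IsHurwitz n) (a : A) (ha : n a ≠ 0) : A ≃ₗ[k] A :=
  LinearEquiv.ofLinearMap (LinearMap.mulRight k a) ((n a)⁻¹ • LinearMap.mulRight k (conj n a))
    (by ext x; simp [hA.mul_conj_mul_self, ha]) (by ext x; simp [hA.mul_mul_conj, ha])

theorem IsHurwitz.mulLeftEquiv_apply (hA : IsHurwitz n) (a : A) (ha : n a ≠ 0) (x : A) :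
    hA.mulLeftEquiv a ha x = a * x := rfl

theorem IsHurwitz.mulRightEquiv_apply (hA : IsHurwitz n) (a : A) (ha : n a ≠ 0) (x : A) :
    hA.mulRightEquiv a ha x = x * a := rfl

/-- The canonical involution as a linear automorphism. -/
noncomputable def IsHurwitz.conjEquiv (hA : IsHurwitz n) : A ≃ₗ[k] A :=
  LinearEquiv.ofInvolutive
    { toFun := conj n, map_add' := conj_add n, map_smul' := conj_smul n } hA.conj_conj

theorem IsHurwitz.conjEquiv_apply (hA : IsHurwitz n) (x : A) : hA.conjEquiv x = conj n x := rfl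

theorem IsHurwitz.hasMultiplier_mulLeftEquiv (hA : IsHurwitz n) (a : A) (ha : n a ≠ 0) :
    HasMultiplier n (hA.mulLeftEquiv a ha) (n a) := fun x => hA.norm_mul a x

variable (k A) in
/-- The linear automorphisms `φ` of `A` with `φ (x y) = φ₁ x φ₂ y` for some `φ₁` and `φ₂`. -/
def autotopy : Subgroup (A ≃ₗ[k] A) where
  carrier := {φ | ∃ φ₁ φ₂ : A ≃ₗ[k] A, ∀ x y, φ (x * y) = φ₁ x * φ₂ y}
  mul_mem' := by
    rintro φ ψ ⟨φ₁, φ₂, hφ⟩ ⟨ψ₁, ψ₂, hψ⟩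
    exact ⟨φ₁ * ψ₁, φ₂ * ψ₂, fun x y => by simp only [LinearEquiv.mul_apply, hψ, hφ]⟩
  one_mem' := ⟨1, 1, fun _ _ => rfl⟩
  inv_mem' := by
    rintro φ ⟨φ₁, φ₂, hφ⟩
    refine ⟨φ₁⁻¹, φ₂⁻¹, fun x y => φ.injective ?_⟩
    rw [hφ]
    exact (φ.apply_symm_apply _).trans
      (congrArg₂ _ (φ₁.apply_symm_apply x).symm (φ₂.apply_symm_apply y).symm)

/-- The left Moufang identity reads `a(xy) = ((ax)a)(a⁻¹y)`. -/
theorem IsHurwitz.mulLeftEquiv_mem_autotopy (hA : IsHurwitz n) (a : A) (ha : n a ≠ 0) :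
    hA.mulLeftEquiv a ha ∈ autotopy k A := by
  refine ⟨hA.mulRightEquiv a ha * hA.mulLeftEquiv a ha, (hA.mulLeftEquiv a ha)⁻¹, fun x y => ?_⟩
  obtain ⟨z, rfl⟩ := (hA.mulLeftEquiv a ha).surjective y
  have h : (hA.mulLeftEquiv a ha)⁻¹ (hA.mulLeftEquiv a ha z) = z :=
    (hA.mulLeftEquiv a ha).symm_apply_apply z
  rw [h]
  exact hA.moufang_left a x z

theorem IsHurwitz.mulRightEquiv_mem_autotopy (hA : IsHurwitz n) (a : A) (ha : n a ≠ 0) :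
    hA.mulRightEquiv a ha ∈ autotopy k A := by
  refine ⟨(hA.mulRightEquiv a ha)⁻¹, hA.mulRightEquiv a ha * hA.mulLeftEquiv a ha, fun x y => ?_⟩
  obtain ⟨z, rfl⟩ := (hA.mulRightEquiv a ha).surjective x
  have h : (hA.mulRightEquiv a ha)⁻¹ (hA.mulRightEquiv a ha z) = z :=
    (hA.mulRightEquiv a ha).symm_apply_apply z
  rw [h]
  exact hA.moufang_right a y z

theorem IsHurwitz.conjEquiv_mul_mul_mem_autotopy (hA : IsHurwitz n) {φ : A ≃ₗ[k] A}
    (hφ : φ ∈ autotopy k A) : hA.conjEquiv * φ * hA.conjEquiv ∈ autotopy k A := by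
  obtain ⟨φ₁, φ₂, h⟩ := hφ
  refine ⟨hA.conjEquiv * φ₂ * hA.conjEquiv, hA.conjEquiv * φ₁ * hA.conjEquiv, fun x y => ?_⟩
  simp only [LinearEquiv.mul_apply, hA.conjEquiv_apply, hA.conj_mul, h]

theorem norm_smul_one_ne_zero (hA : IsHurwitz n) {c : k} (hc : c ≠ 0) : n (c • (1 : A)) ≠ 0 := by
  rw [map_smul_eq, hA.norm_one, mul_one]; exact pow_ne_zero 2 hc

/-- With `x̄` the conjugate of `x`, `(s x̄)s = ⟨s,x⟩s - n(s)x`. The scalar is written as a left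
multiplication so that every factor before the involution is an autotopy. -/
theorem IsHurwitz.reflect_eq (hA : IsHurwitz n) (s : A) (hs : n s ≠ 0) :
    reflect n s hs =
      hA.mulLeftEquiv ((-(n s)⁻¹) • 1)
        (norm_smul_one_ne_zero hA (neg_ne_zero.2 (inv_ne_zero hs))) *
        hA.mulRightEquiv s hs * hA.mulLeftEquiv s hs * hA.conjEquiv := by
  ext x
  simp only [LinearEquiv.mul_apply, hA.conjEquiv_apply, hA.mulLeftEquiv_apply,
    hA.mulRightEquiv_apply, reflect_apply, hA.mul_mul_self, hA.conj_conj, smul_mul_assoc, one_mul]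
  rw [QuadraticMap.polar_comm n s]
  match_scalars <;> field_simp

theorem IsHurwitz.reflect_mul_mem_autotopy (hA : IsHurwitz n) (s : A) (hs : n s ≠ 0)
    {φ : A ≃ₗ[k] A} (hφ : φ ∈ autotopy k A) :
    reflect n s hs * φ * hA.conjEquiv ∈ autotopy k A := by
  rw [hA.reflect_eq, mul_assoc, mul_assoc, ← mul_assoc hA.conjEquiv]
  exact mul_mem (mul_mem (mul_mem (hA.mulLeftEquiv_mem_autotopy _ _)
    (hA.mulRightEquiv_mem_autotopy _ _)) (hA.mulLeftEquiv_mem_autotopy _ _))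
    (hA.conjEquiv_mul_mul_mem_autotopy hφ)

/-- The norm of a Hurwitz algebra is determined by the multiplication. -/
theorem IsHurwitz.norm_unique {n' : QuadraticForm k A} (hA : IsHurwitz n) (hA' : IsHurwitz n')
    (x : A) : n' x = n x := by
  have h := (hA.mul_self_eq x).symm.trans (hA'.mul_self_eq x)
  by_cases hx : polar n x 1 = polar n' x 1
  · rw [hx, sub_right_inj] at h
    have := hA.nontrivial
    exact (smul_left_injective k (one_ne_zero (α := A)) h).symm
  · obtain ⟨c, rfl⟩ : ∃ c : k, x = c • (1 : A) := by
      refine ⟨(polar n x 1 - polar n' x 1)⁻¹ * (n x - n' x), ?_⟩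
      replace hx := sub_ne_zero.2 hx
      have h' : (polar n x 1 - polar n' x 1) • x = (n x - n' x) • (1 : A) := by
        rw [sub_smul, sub_smul]
        rw [← sub_eq_zero] at h ⊢
        rw [← h]; abel
      rw [mul_smul, ← h', inv_smul_smul₀ hx]
    rw [map_smul_eq, map_smul_eq, hA.norm_one, hA'.norm_one]

theorem IsHurwitz.norm_ne_zero_of_autotopy (hA : IsHurwitz n) {φ φ₁ φ₂ : A ≃ₗ[k] A}
    (h : ∀ x y, φ (x * y) = φ₁ x * φ₂ y) : n (φ₁ 1) ≠ 0 ∧ n (φ₂ 1) ≠ 0 := by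
  constructor
  · intro h0
    obtain ⟨y, hy⟩ := φ.surjective 1
    have := congrArg n (h 1 y)
    rw [one_mul, hy, hA.norm_mul, h0, zero_mul] at this
    exact hA.norm_one_ne_zero this
  · intro h0
    obtain ⟨x, hx⟩ := φ.surjective 1
    have := congrArg n (h x 1)
    rw [mul_one, hx, hA.norm_mul, h0, mul_zero] at this
    exact hA.norm_one_ne_zero this

/-- Multiplicativity of `n(φ(1))⁻¹ n∘φ` comes from `n(φ x) = n(φ₁ x) n(φ₂ 1)` and `n(φ y) = n(φ₁ 1)
n(φ₂ y)`; uniqueness of the norm then applies. -/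
theorem IsHurwitz.autotopy_mem_GO (hA : IsHurwitz n) {φ : A ≃ₗ[k] A} (hφ : φ ∈ autotopy k A) :
    φ ∈ GO n := by
  obtain ⟨φ₁, φ₂, h⟩ := hφ
  obtain ⟨ha, hb⟩ := hA.norm_ne_zero_of_autotopy h
  have h1 : n (φ 1) = n (φ₁ 1) * n (φ₂ 1) := by rw [← hA.norm_mul, ← h, one_mul]
  have hc : n (φ 1) ≠ 0 := by rw [h1]; exact mul_ne_zero ha hb
  let n' : QuadraticForm k A := (n (φ 1))⁻¹ • n.comp (φ : A →ₗ[k] A)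
  have hn' : ∀ x, n' x = (n (φ 1))⁻¹ * n (φ x) := fun x => rfl
  have hA' : IsHurwitz n' := by
    refine ⟨hA.nontrivial, fun x hx => ?_, fun x y => ?_⟩
    · refine φ.map_eq_zero_iff.1 (hA.nondegenerate _ fun z => ?_)
      obtain ⟨y, rfl⟩ := φ.surjective z
      have := hx y
      simp only [polar, hn', ← mul_sub, map_add, mul_eq_zero, inv_eq_zero, hc, false_or] at this
      exact this
    · have hx : n (φ x) = n (φ₁ x) * n (φ₂ 1) := by rw [← hA.norm_mul, ← h, mul_one]
      have hy : n (φ y) = n (φ₁ 1) * n (φ₂ y) := by rw [← hA.norm_mul, ← h, one_mul]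
      rw [hn', hn', hn', h, hA.norm_mul, hx, hy, h1]
      field_simp
  refine ⟨n (φ 1), fun x => ?_⟩
  rw [← hA.norm_unique hA' x, hn', mul_inv_cancel_left₀ hc]

section FiniteDimensional

variable [FiniteDimensional k A]

theorem finrank_span_pair_le (x y : A) : finrank k (Submodule.span k {x, y}) ≤ 2 := by
  classical
  have := (finrank_span_finset_le_card (R := k) ({x, y} : Finset A)).trans Finset.card_le_two
  rwa [Set.finrank, Finset.coe_pair] at this

theorem finrank_span_triple_le (x y z : A) : finrank k (Submodule.span k {x, y, z}) ≤ 3 := by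
  classical
  have := (finrank_span_finset_le_card (R := k) ({x, y, z} : Finset A)).trans Finset.card_le_three
  rwa [Set.finrank, Finset.coe_insert, Finset.coe_pair] at this

/-- Otherwise the orthogonal space of `1, a` is totally singular, hence inside their span. By
dimension the two coincide, although 1 is nonsingular. -/
theorem IsHurwitz.exists_nonsingular_orthogonal (hA : IsHurwitz n) (hd : 4 ≤ finrank k A) (a : A) :
    ∃ v, polar n v 1 = 0 ∧ polar n v a = 0 ∧ n v ≠ 0 := by
  by_contra! hcon
  set Y := Submodule.span k {1, a} with hY
  set W := LinearMap.BilinForm.orthogonal n.polarBilin Y with hW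
  have h1 : (1 : A) ∈ Y := Submodule.subset_span (by simp)
  have ha : a ∈ Y := Submodule.subset_span (by simp)
  have hsing : ∀ x ∈ W, n x = 0 := fun x hx => by
    have hx := LinearMap.BilinForm.mem_orthogonal_iff.1 hx
    refine hcon x ?_ ?_
    · rw [QuadraticMap.polar_comm]; exact hx 1 h1
    · rw [QuadraticMap.polar_comm]; exact hx a ha
  have hWY : W ≤ Y := by
    have := le_orthogonal_of_singular hsing
    rwa [hW, orthogonal_orthogonal_eq hA.nondegenerate, ← hW] at this
  have h2 := finrank_orthogonal_add hA.nondegenerate Y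
  rw [← hW] at h2
  have h3 := Submodule.finrank_mono hWY
  have h4 : finrank k Y ≤ 2 := finrank_span_pair_le 1 a
  have hWeq : W = Y := Submodule.eq_of_le_of_finrank_eq hWY (by omega)
  exact hA.norm_one_ne_zero (hsing 1 (hWeq ▸ h1))

/-- For nonsingular `v` orthogonal to 1 and `a`, `av + va = ⟨a,1⟩v` gives `2a = ⟨a,1⟩1`. In
characteristic two this says only `⟨a,1⟩ = 0`, and some `u` with `⟨u,1⟩ ≠ 0` then gives `⟨u,1⟩a =
⟨a,u⟩1`. -/
theorem IsHurwitz.eq_smul_one_of_commute (hA : IsHurwitz n) (hd : 4 ≤ finrank k A) {a : A}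
    (h : ∀ x, a * x = x * a) : ∃ c : k, a = c • (1 : A) := by
  have := hA.nontrivial
  obtain ⟨v, hv1, hva, hv⟩ := hA.exists_nonsingular_orthogonal hd a
  have h1 := hA.mul_add_mul a v
  rw [← h, hv1, QuadraticMap.polar_comm n a v, hva, zero_smul, zero_smul, add_zero, sub_zero] at h1
  have h2 : (2 : k) • a = polar n a 1 • (1 : A) := by
    refine (hA.mulRightEquiv v hv).injective ?_
    rw [hA.mulRightEquiv_apply, hA.mulRightEquiv_apply, smul_mul_assoc, smul_mul_assoc, one_mul,
      two_smul, h1]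
  by_cases h20 : (2 : k) = 0
  · rw [h20, zero_smul, eq_comm, smul_eq_zero_iff_left one_ne_zero] at h2
    obtain ⟨u, hu⟩ : ∃ u, polar n (1 : A) u ≠ 0 := by
      by_contra! h0
      exact one_ne_zero (hA.nondegenerate 1 h0)
    rw [QuadraticMap.polar_comm] at hu
    have h3 := hA.mul_add_mul a u
    rw [← h, h2, ← two_smul k, h20, zero_smul, zero_smul, zero_add, eq_comm, sub_eq_zero] at h3
    exact ⟨(polar n u 1)⁻¹ * polar n a u, by rw [mul_smul, ← h3, inv_smul_smul₀ hu]⟩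
  · exact ⟨2⁻¹ * polar n a 1, by rw [mul_smul, ← h2, inv_smul_smul₀ h20]⟩

theorem IsHurwitz.conjEquiv_notMem_autotopy (hA : IsHurwitz n) (hd : 4 ≤ finrank k A) :
    hA.conjEquiv ∉ autotopy k A := by
  rintro ⟨κ₁, κ₂, h⟩
  have := hA.nontrivial
  obtain ⟨ha, hb⟩ := hA.norm_ne_zero_of_autotopy h
  simp only [hA.conjEquiv_apply] at h
  set a := κ₁ 1
  set b := κ₂ 1
  have hab : a * b = 1 := by rw [← h, one_mul, hA.conj_one]
  have hbE : b = (n a)⁻¹ • conj n a := by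
    have := hA.conj_mul_mul a b
    rw [hab, mul_one] at this
    rw [this, inv_smul_smul₀ ha]
  have haE : a = (n b)⁻¹ • conj n b := by
    have := hA.mul_mul_conj b a
    rw [hab, one_mul] at this
    rw [this, inv_smul_smul₀ hb]
  have hκ₁ : ∀ x, κ₁ x = conj n x * a := fun x => by
    have h1 : conj n x = κ₁ x * b := by rw [← h, mul_one]
    rw [haE, mul_smul_comm, h1, hA.mul_mul_conj, inv_smul_smul₀ hb]
  have hκ₂ : ∀ y, κ₂ y = b * conj n y := fun y => by
    have h1 : conj n y = a * κ₂ y := by rw [← h, one_mul]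
    rw [hbE, smul_mul_assoc, h1, hA.conj_mul_mul, inv_smul_smul₀ ha]
  -- Taking `y = a` here shows that `a` commutes with everything, so it is a scalar. Then `A` is
  -- commutative, and all its elements are scalars.
  have hmul : ∀ x y, y * x = (x * a) * (b * y) := fun x y => by
    have := h (conj n x) (conj n y)
    rwa [hA.conj_mul, hκ₁, hκ₂, hA.conj_conj, hA.conj_conj] at this
  have hba : b * a = 1 := by
    have := hA.conj_mul_mul a 1
    rw [mul_one] at this
    rw [hbE, smul_mul_assoc, this, inv_smul_smul₀ ha]
  obtain ⟨c, hc⟩ := hA.eq_smul_one_of_commute hd (a := a) fun x => by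
    rw [hmul x a, hba, mul_one]
  have hcomm : ∀ x y, y * x = x * y := fun x y => by
    have hcb : c • b = 1 := by rw [← hab, hc, smul_mul_assoc, one_mul]
    rw [hmul, hc, mul_smul_comm, mul_one, smul_mul_assoc, ← mul_smul_comm, ← smul_mul_assoc, hcb,
      one_mul]
  have : finrank k A ≤ 1 := finrank_le_one (1 : A) fun w => by
    obtain ⟨c, hc⟩ := hA.eq_smul_one_of_commute hd (a := w) fun x => hcomm x w
    exact ⟨c, hc.symm⟩
  omega

theorem mul_comm_of_finrank_le_two [Nontrivial A] (hd : finrank k A ≤ 2) (x y : A) :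
    x * y = y * x := by
  by_cases hx : ∃ c : k, c • (1 : A) = x
  · obtain ⟨c, rfl⟩ := hx
    simp
  · push Not at hx
    have hli : LinearIndependent k ![(1 : A), x] :=
      (LinearIndependent.pair_iff' one_ne_zero).2 hx
    have hcard : Fintype.card (Fin 2) = finrank k A := by
      have := hli.fintype_card_le_finrank
      simp at this ⊢
      omega
    have htop := hli.span_eq_top_of_card_eq_finrank' hcard
    have hy : y ∈ Submodule.span k {1, x} := by
      have : y ∈ (⊤ : Submodule k A) := trivial
      rw [← htop] at this
      simpa [Set.pair_comm] using this
    obtain ⟨c, d, rfl⟩ := Submodule.mem_span_pair.1 hy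
    simp [mul_add, add_mul, mul_smul_comm, smul_mul_assoc]

theorem IsHurwitz.conjEquiv_mem_autotopy (hA : IsHurwitz n) (hd : finrank k A ≤ 2) :
    hA.conjEquiv ∈ autotopy k A := by
  have := hA.nontrivial
  refine ⟨hA.conjEquiv, hA.conjEquiv, fun x y => ?_⟩
  rw [hA.conjEquiv_apply, hA.conj_mul, mul_comm_of_finrank_le_two hd]
  rfl

end FiniteDimensional

end Hurwitz

/-! ### Properness of left multiplications and the description of `G(A)`. -/

section Hurwitz

variable {k A : Type*} [Field k] [NonAssocRing A] [Module k A] [IsScalarTower k A A]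
  [SMulCommClass k A A] [FiniteDimensional k A] {n : QuadraticForm k A}

set_option linter.unusedSectionVars false

theorem IsHurwitz.mulLeft_mul_add (hA : IsHurwitz n) (x y : A) :
    LinearMap.mulLeft k x * LinearMap.mulLeft k y + LinearMap.mulLeft k y * LinearMap.mulLeft k x =
      polar n x 1 • LinearMap.mulLeft k y + polar n y 1 • LinearMap.mulLeft k x
        - polar n x y • (1 : Module.End k A) := by
  ext z
  exact hA.mul_mul_add_mul_mul x y z

theorem IsHurwitz.exists_polar_ne_zero_orthogonal (hA : IsHurwitz n) (hd : 6 ≤ finrank k A)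
    {u : A} (hu : polar n u 1 ≠ 0) (v : A) :
    ∃ w w', (polar n w 1 = 0 ∧ polar n w u = 0 ∧ polar n w v = 0) ∧
      (polar n w' 1 = 0 ∧ polar n w' u = 0 ∧ polar n w' v = 0) ∧ polar n w w' ≠ 0 := by
  by_contra! hcon
  set Y := Submodule.span k {1, u, v} with hY
  set W := LinearMap.BilinForm.orthogonal n.polarBilin Y with hW
  have h1 : (1 : A) ∈ Y := Submodule.subset_span (by simp)
  have hu' : u ∈ Y := Submodule.subset_span (by simp)
  have hv' : v ∈ Y := Submodule.subset_span (by simp)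
  have hmem : ∀ x ∈ W, polar n x 1 = 0 ∧ polar n x u = 0 ∧ polar n x v = 0 := fun x hx => by
    have hx := LinearMap.BilinForm.mem_orthogonal_iff.1 hx
    simp only [QuadraticMap.polar_comm n x]
    exact ⟨hx 1 h1, hx u hu', hx v hv'⟩
  have hWY : W ≤ Y := by
    rw [← orthogonal_orthogonal_eq hA.nondegenerate Y, ← hW]
    intro x hx
    rw [LinearMap.BilinForm.mem_orthogonal_iff]
    intro y hy
    exact hcon y x (hmem y hy) (hmem x hx)
  have h2 := finrank_orthogonal_add hA.nondegenerate Y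
  rw [← hW] at h2
  have h3 := Submodule.finrank_mono hWY
  have h4 : finrank k Y ≤ 3 := finrank_span_triple_le 1 u v
  have hWeq : W = Y := Submodule.eq_of_le_of_finrank_eq hWY (by omega)
  exact hu (hmem u (hWeq ▸ hu')).1

/-- The trace is `(dim A / 2)⟨u,1⟩`, which settles dimension 4. Beyond that, `L_u` is a multiple of
a commutator: for `v, w, w'` orthogonal to 1 and `u`, with `w, w'` also orthogonal to `v`, the
products `L_v L_w` and `L_v L_w'` commute with `L_u`, and their commutator is the scalar
`-n(v)⟨w,w'⟩`. -/
theorem IsHurwitz.trace_mulLeft_eq_zero [CharP k 2] (hA : IsHurwitz n) (hd : 4 ≤ finrank k A)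
    {u : A} (hu : polar n u 1 = 1) : LinearMap.trace k A (LinearMap.mulLeft k u) = 0 := by
  have heven := hA.even_finrank (by omega)
  rcases eq_or_lt_of_le hd with h4 | h4
  · rw [hA.trace_mulLeft heven, ← h4]
    simp [CharTwo.two_eq_zero]
  · have hu0 : polar n u 1 ≠ 0 := by rw [hu]; exact one_ne_zero
    obtain ⟨v, hv1, hvu, hv⟩ := hA.exists_nonsingular_orthogonal hd u
    obtain ⟨w, w', ⟨hw1, hwu, hwv⟩, ⟨hw1', hwu', hwv'⟩, hww⟩ :=
      hA.exists_polar_ne_zero_orthogonal (by obtain ⟨m, hm⟩ := heven; omega) hu0 v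
    have huv := hA.mulLeft_mul_add v u
    have huw := hA.mulLeft_mul_add w u
    have huw' := hA.mulLeft_mul_add w' u
    have hvw := hA.mulLeft_mul_add w v
    have hvw' := hA.mulLeft_mul_add w' v
    have hww' := hA.mulLeft_mul_add w w'
    have hvv : LinearMap.mulLeft k v * LinearMap.mulLeft k v = -n v • (1 : Module.End k A) := by
      ext z
      have := hA.mul_mul_left_eq v z
      rw [hv1, zero_smul, zero_sub] at this
      simpa using this
    simp only [hu, hv1, hvu, hw1, hwu, hwv, hw1', hwu', hwv', zero_smul, one_smul, zero_add,
      add_zero, sub_zero, zero_sub] at huv huw huw' hvw hvw' hww'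
    generalize LinearMap.mulLeft k u = U at *
    generalize LinearMap.mulLeft k v = V at *
    generalize LinearMap.mulLeft k w = W at *
    generalize LinearMap.mulLeft k w' = W' at *
    have comm : ∀ Z : Module.End k A, Z * U + U * Z = Z → (V * Z) * U = U * (V * Z) := by
      intro Z hZ
      rw [mul_assoc, eq_sub_of_add_eq hZ, ← mul_assoc, eq_sub_of_add_eq' huv]
      noncomm_ring
    have hX := comm W huw
    have hY := comm W' huw'
    have hXY : (V * W) * (V * W') = n v • (W * W') := by
      rw [mul_assoc, ← mul_assoc W, eq_neg_of_add_eq_zero_left hvw]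
      rw [neg_mul, mul_neg, mul_assoc V W, ← mul_assoc V V, hvv]
      simp
    have hYX : (V * W') * (V * W) = n v • (W' * W) := by
      rw [mul_assoc, ← mul_assoc W', eq_neg_of_add_eq_zero_left hvw']
      rw [neg_mul, mul_neg, mul_assoc V W', ← mul_assoc V V, hvv]
      simp
    have hcomm : U * (V * W) * (V * W') - (V * W') * (U * (V * W)) =
        (-(n v * polar n w w')) • U := by
      rw [← mul_assoc (V * W') U, hY, mul_assoc U, mul_assoc U, hXY, hYX, ← mul_sub, ← smul_sub,
        show W * W' - W' * W = W * W' + W' * W from ?_, hww']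
      · rw [mul_smul_comm, mul_neg, mul_smul_comm, mul_one]
        module
      · have : (2 : k) • (W' * W) = 0 := by rw [CharTwo.two_eq_zero, zero_smul]
        rw [two_smul] at this
        rw [sub_eq_iff_eq_add, add_assoc, this, add_zero]
    have htr := congrArg (LinearMap.trace k A) hcomm
    rw [map_sub, LinearMap.trace_mul_comm, sub_self, map_smul, smul_eq_mul, eq_comm,
      mul_eq_zero] at htr
    exact htr.resolve_left (neg_ne_zero.2 (mul_ne_zero hv hww))

theorem IsHurwitz.exists_polar_one_eq_one (hA : IsHurwitz n) : ∃ u : A, polar n u 1 = 1 := by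
  have := hA.nontrivial
  obtain ⟨u, hu⟩ : ∃ u, polar n (1 : A) u ≠ 0 := by
    by_contra! h0
    exact one_ne_zero (hA.nondegenerate 1 h0)
  rw [QuadraticMap.polar_comm] at hu
  exact ⟨(polar n u 1)⁻¹ • u, by
    rw [QuadraticMap.polar_smul_left, smul_eq_mul, inv_mul_cancel₀ hu]⟩

theorem IsHurwitz.exists_polar_one_eq_one_of_ne (hA : IsHurwitz n) {a : A}
    (ha : ∀ c : k, a ≠ c • (1 : A)) : ∃ u : A, polar n u 1 = 1 ∧ polar n u a = 0 := by
  have h1 : (1 : A) ∉ Submodule.span k {a} := fun h => by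
    obtain ⟨c, hc⟩ := Submodule.mem_span_singleton.1 h
    have := hA.nontrivial
    have hc0 : c ≠ 0 := by
      rintro rfl
      rw [zero_smul] at hc
      exact zero_ne_one hc
    exact ha c⁻¹ (by rw [← hc, inv_smul_smul₀ hc0])
  obtain ⟨f, hf1, hfa⟩ := Submodule.exists_dual_map_eq_bot_of_notMem h1 inferInstance
  obtain ⟨u, hu⟩ := exists_polar_eq hA.nondegenerate f
  refine ⟨(f 1)⁻¹ • u, ?_, ?_⟩
  · rw [QuadraticMap.polar_smul_left, hu, smul_eq_mul, inv_mul_cancel₀ hf1]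
  · have : f a = 0 := by
      have h : f a ∈ (Submodule.span k {a}).map f :=
        Submodule.mem_map_of_mem (Submodule.mem_span_singleton_self a)
      rwa [hfa, Submodule.mem_bot] at h
    rw [QuadraticMap.polar_smul_left, hu, this, smul_zero]

/-- The form `B(x,y) = ⟨ux,y⟩` with `⟨u,1⟩ = 1` satisfies `B(x,x) = n(x)`, and `u` can be adapted to
`a`. If `⟨a,1⟩ ≠ 0` take `u` proportional to `a`, and if `a` is a scalar take any `u`; both give `T
= 0`. Otherwise take `u` orthogonal to `a`; then `T = n(a)L_u`, of trace zero. -/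
theorem IsHurwitz.hasDicksonInvariant_mulLeftEquiv [CharP k 2] (hA : IsHurwitz n)
    (hd : 4 ≤ finrank k A) (a : A) (ha : n a ≠ 0) :
    HasDicksonInvariant n (hA.mulLeftEquiv a ha) 0 := by
  have hB : ∀ u : A, polar n u 1 = 1 →
      ∀ x, (n.polarBilin ∘ₗ LinearMap.mulLeft k u) x x = n x := fun u hu x => by
    change polar n (u * x) x = n x
    have := hA.polar_mul_right x u 1
    rwa [one_mul, hu, mul_one] at this
  by_cases hat : polar n a 1 = 0
  · by_cases hak : ∃ c : k, a = c • (1 : A)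
    · obtain ⟨c, rfl⟩ := hak
      obtain ⟨u, hu⟩ := hA.exists_polar_one_eq_one
      refine ⟨_, _, 0, hA.hasMultiplier_mulLeftEquiv _ ha, hB u hu, fun x y => ?_, by simp⟩
      simp only [hA.mulLeftEquiv_apply, smul_mul_assoc, one_mul, map_smul_eq, hA.norm_one, map_smul,
        LinearMap.smul_apply, smul_eq_mul, LinearMap.zero_apply, QuadraticMap.polar_zero_left]
      ring
    · push Not at hak
      obtain ⟨u, hu, hua⟩ := hA.exists_polar_one_eq_one_of_ne hak
      refine ⟨_, _, n a • LinearMap.mulLeft k u, hA.hasMultiplier_mulLeftEquiv _ ha, hB u hu,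
        fun x y => ?_, by rw [map_smul, hA.trace_mulLeft_eq_zero hd hu]; simp⟩
      change polar n (u * (a * x)) (a * y) - n a * polar n (u * x) y =
        polar n (n a • (u * x)) y - polar n (n a • (u * y)) x
      have h := hA.mul_mul_add_mul_mul u a x
      rw [hu, hat, hua, one_smul, zero_smul, zero_smul, add_zero, sub_zero] at h
      have h2 : polar n (u * y) x = polar n x y - polar n (u * x) y := by
        rw [hA.polar_mul_eq_left, conj, hu, one_smul, sub_mul, one_mul,
          QuadraticMap.polar_sub_right, QuadraticMap.polar_comm n y, QuadraticMap.polar_comm n y]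
      rw [eq_sub_of_add_eq h, QuadraticMap.polar_sub_left, hA.polar_mul_left, hA.polar_mul_left,
        QuadraticMap.polar_smul_left, QuadraticMap.polar_smul_left, h2, smul_eq_mul, smul_eq_mul]
      have h20 : (2 : k) = 0 := CharTwo.two_eq_zero
      linear_combination (n a * polar n x y - 2 * n a * polar n (u * x) y) * h20
  · have hu : polar n ((polar n a 1)⁻¹ • a) 1 = 1 := by
      rw [QuadraticMap.polar_smul_left, smul_eq_mul, inv_mul_cancel₀ hat]
    refine ⟨_, _, 0, hA.hasMultiplier_mulLeftEquiv _ ha, hB _ hu, fun x y => ?_, by simp⟩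
    change polar n (((polar n a 1)⁻¹ • a) * (a * x)) (a * y) -
      n a * polar n (((polar n a 1)⁻¹ • a) * x) y = polar n 0 y - polar n 0 x
    simp only [smul_mul_assoc, QuadraticMap.polar_smul_left, hA.polar_mul_left,
      QuadraticMap.polar_zero_left, smul_eq_mul]
    ring

/-- `φ` is a similitude whose class modulo the proper similitudes is the parity of `i`. -/
def HasSign (n : QuadraticForm k A) (φ : A ≃ₗ[k] A) (i : ℕ) : Prop :=
  (ringChar k ≠ 2 → ∃ μ : k, HasMultiplier n φ μ ∧
    LinearMap.det (φ : A →ₗ[k] A) = (-1) ^ i * μ ^ (finrank k A / 2)) ∧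
  (ringChar k = 2 → HasDicksonInvariant n φ i)

theorem HasSign.mul (hA : IsHurwitz n) {φ ψ : A ≃ₗ[k] A} {i j : ℕ} (hφ : HasSign n φ i)
    (hψ : HasSign n ψ j) : HasSign n (φ * ψ) (i + j) := by
  refine ⟨fun h => ?_, fun h => ?_⟩
  · obtain ⟨μ, hμ, hdet⟩ := hφ.1 h
    obtain ⟨ν, hν, hdet'⟩ := hψ.1 h
    refine ⟨μ * ν, hμ.mul hν, ?_⟩
    have : ((φ * ψ : A ≃ₗ[k] A) : A →ₗ[k] A) = (φ : A →ₗ[k] A) ∘ₗ (ψ : A →ₗ[k] A) := rfl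
    rw [this, LinearMap.det_comp, hdet, hdet']
    ring
  · rw [Nat.cast_add]
    exact (hφ.2 h).mul hA.nondegenerate hA.norm_one_ne_zero (hψ.2 h)

theorem IsHurwitz.hasSign_reflect (hA : IsHurwitz n) (s : A) (hs : n s ≠ 0) :
    HasSign n (reflect n s hs) 1 := by
  refine ⟨fun _ => ⟨1, hasMultiplier_reflect s hs, by rw [det_reflect]; simp⟩, fun h => ?_⟩
  have : CharP k 2 := ringChar.of_eq h
  have := hasDicksonInvariant_reflect hA.nondegenerate s hs
  rwa [CharTwo.neg_eq, ← Nat.cast_one] at this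

theorem IsHurwitz.hasSign_mulLeftEquiv (hA : IsHurwitz n) (hd : 4 ≤ finrank k A) (a : A)
    (ha : n a ≠ 0) : HasSign n (hA.mulLeftEquiv a ha) 0 := by
  refine ⟨fun _ => ⟨n a, hA.hasMultiplier_mulLeftEquiv a ha, ?_⟩, fun h => ?_⟩
  · rw [pow_zero, one_mul, ← hA.det_mulLeft (hA.even_finrank (by omega))]
    rfl
  · have : CharP k 2 := ringChar.of_eq h
    rw [Nat.cast_zero]
    exact hA.hasDicksonInvariant_mulLeftEquiv hd a ha

theorem IsHurwitz.hasSign_one (hA : IsHurwitz n) (hd : 4 ≤ finrank k A) :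
    HasSign n (1 : A ≃ₗ[k] A) 0 := by
  convert hA.hasSign_mulLeftEquiv hd 1 hA.norm_one_ne_zero
  ext x
  simp [hA.mulLeftEquiv_apply]

theorem HasSign.even_iff (hA : IsHurwitz n) {φ : A ≃ₗ[k] A} {i j : ℕ} (h : HasSign n φ i)
    (h' : HasSign n φ j) : Even i ↔ Even j := by
  by_cases hk : ringChar k = 2
  · have : CharP k 2 := ringChar.of_eq hk
    have hij := (h.2 hk).unique hA.nondegenerate hA.norm_one_ne_zero (h'.2 hk)
    rw [CharP.natCast_eq_natCast k 2] at hij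
    rw [Nat.even_iff, Nat.even_iff, hij]
  · obtain ⟨μ, hμ, hdet⟩ := h.1 hk
    obtain ⟨ν, hν, hdet'⟩ := h'.1 hk
    obtain rfl := hμ.unique hA.norm_one_ne_zero hν
    have hij := mul_right_cancel₀ (pow_ne_zero _ (hμ.ne_zero hA.norm_one_ne_zero))
      (hdet.symm.trans hdet')
    have hne : (-1 : k) ≠ 1 := Ring.neg_one_ne_one_of_char_ne_two hk
    rcases Nat.even_or_odd i with hi | hi <;> rcases Nat.even_or_odd j with hj | hj
    · simp [hi, hj]
    · rw [hi.neg_one_pow, hj.neg_one_pow] at hij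
      exact absurd hij.symm hne
    · rw [hi.neg_one_pow, hj.neg_one_pow] at hij
      exact absurd hij hne
    · simp [Nat.not_even_iff_odd.2 hi, Nat.not_even_iff_odd.2 hj]

theorem mem_GOPlus_iff {φ : A ≃ₗ[k] A} : φ ∈ GOPlus n ↔ φ ∈ GO n ∧ HasSign n φ 0 := by
  simp only [GOPlus, HasSign, Set.mem_ofPred_eq, pow_zero, one_mul, Nat.cast_zero]

theorem HasSign.of_even {φ : A ≃ₗ[k] A} {i : ℕ} (h : HasSign n φ i) (hi : Even i) :
    HasSign n φ 0 := by
  refine ⟨fun hk => ?_, fun hk => ?_⟩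
  · obtain ⟨μ, hμ, hdet⟩ := h.1 hk
    exact ⟨μ, hμ, by rw [hdet, hi.neg_one_pow, pow_zero]⟩
  · have : CharP k 2 := ringChar.of_eq hk
    have := h.2 hk
    rwa [(CharP.cast_eq_zero_iff k 2 i).2 hi.two_dvd, ← Nat.cast_zero] at this

/-- Up to powers of the canonical involution, every similitude is an autotopy, and the exponent
is given by its sign. -/
theorem IsHurwitz.exists_hasSign (hA : IsHurwitz n) {φ : A ≃ₗ[k] A} (hφ : φ ∈ GO n) :
    ∃ i, (4 ≤ finrank k A → HasSign n φ i) ∧ φ * hA.conjEquiv ^ i ∈ autotopy k A := by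
  have := hA.nontrivial
  obtain ⟨μ, hμ⟩ := hφ
  have hμa : n (φ 1) = μ := by rw [hμ, hA.norm_one, mul_one]
  have ha : n (φ 1) ≠ 0 := hμa ▸ hμ.ne_zero hA.norm_one_ne_zero
  set L := hA.mulLeftEquiv (φ 1) ha with hL
  have hσ : HasMultiplier n (L⁻¹ * φ) 1 := by
    have := ((hA.hasMultiplier_mulLeftEquiv (φ 1) ha).inv hA.norm_one_ne_zero).mul hμ
    rwa [hμa, inv_mul_cancel₀ (hμa ▸ ha)] at this
  have hσ1 : (L⁻¹ * φ) 1 = 1 := by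
    refine L.injective ((L.apply_symm_apply _).trans ?_)
    rw [hL, hA.mulLeftEquiv_apply, mul_one]
    rfl
  have key : ∃ i, (4 ≤ finrank k A → HasSign n (L⁻¹ * φ) i) ∧
      (L⁻¹ * φ) * hA.conjEquiv ^ i ∈ autotopy k A := by
    have hone : ∃ i, (4 ≤ finrank k A → HasSign n (1 : A ≃ₗ[k] A) i) ∧
        1 * hA.conjEquiv ^ i ∈ autotopy k A :=
      ⟨0, hA.hasSign_one, by simp⟩
    -- Generation by reflections needs even dimension; in dimension 1 an automorphism fixing 1 is
    -- the identity.
    by_cases hd : 2 ≤ finrank k A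
    · refine isometry_induction (C := fun σ => ∃ i, (4 ≤ finrank k A → HasSign n σ i) ∧
        σ * hA.conjEquiv ^ i ∈ autotopy k A) hA.nondegenerate (hA.even_finrank hd)
        hA.norm_one_ne_zero hone ?_ hσ hσ1
      rintro s hs σ ⟨i, hi, hmem⟩
      refine ⟨1 + i, fun h => (hA.hasSign_reflect s hs).mul hA (hi h), ?_⟩
      have := hA.reflect_mul_mem_autotopy s hs hmem
      rwa [add_comm 1 i, pow_succ, ← mul_assoc, mul_assoc (reflect n s hs)]
    · have h1 : finrank k A = 1 := by
        have := Module.finrank_pos (R := k) (M := A)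
        omega
      have : L⁻¹ * φ = 1 := by
        ext x
        obtain ⟨c, rfl⟩ := (finrank_eq_one_iff_of_nonzero' (1 : A) one_ne_zero).1 h1 x
        rw [map_smul, hσ1]
        rfl
      rwa [this]
  obtain ⟨i, hi, hmem⟩ := key
  have hφL : φ = L * (L⁻¹ * φ) := by rw [mul_inv_cancel_left]
  refine ⟨0 + i, fun h => ?_, ?_⟩
  · rw [hφL]
    exact (hA.hasSign_mulLeftEquiv h _ ha).mul hA (hi h)
  · rw [zero_add, hφL, mul_assoc]
    exact mul_mem (hA.mulLeftEquiv_mem_autotopy _ ha) hmem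

theorem IsHurwitz.conjEquiv_mul_self (hA : IsHurwitz n) : hA.conjEquiv * hA.conjEquiv = 1 :=
  LinearEquiv.ext hA.conj_conj

theorem IsHurwitz.conjEquiv_pow_of_even (hA : IsHurwitz n) {i : ℕ} (hi : Even i) :
    hA.conjEquiv ^ i = 1 := by
  obtain ⟨m, rfl⟩ := hi
  rw [← two_mul, pow_mul, sq, hA.conjEquiv_mul_self, one_pow]

theorem IsHurwitz.finrank_le_two_or (hA : IsHurwitz n) : finrank k A ≤ 2 ∨ 4 ≤ finrank k A := by
  by_cases h : finrank k A ≤ 2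
  · exact Or.inl h
  · obtain ⟨m, hm⟩ := hA.even_finrank (by omega)
    omega

/-- The group `G(A)` consists of the linear automorphisms that are part of an autotopy. -/
theorem IsHurwitz.mem_G_iff (hA : IsHurwitz n) {φ : A ≃ₗ[k] A} :
    φ ∈ G n ↔ φ ∈ autotopy k A := by
  rcases hA.finrank_le_two_or with hd | hd
  · rw [G, if_pos hd]
    refine ⟨fun hφ => ?_, hA.autotopy_mem_GO⟩
    obtain ⟨i, -, hmem⟩ := hA.exists_hasSign hφ
    exact (mul_mem_cancel_right (pow_mem (hA.conjEquiv_mem_autotopy hd) i)).1 hmem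
  · rw [G, if_neg (by omega), mem_GOPlus_iff]
    constructor
    · rintro ⟨hφ, hsign⟩
      obtain ⟨i, hi, hmem⟩ := hA.exists_hasSign hφ
      have heven : Even i := (hsign.even_iff hA (hi hd)).1 Even.zero
      rwa [hA.conjEquiv_pow_of_even heven, mul_one] at hmem
    · intro hφ
      have hGO := hA.autotopy_mem_GO hφ
      obtain ⟨i, hi, hmem⟩ := hA.exists_hasSign hGO
      refine ⟨hGO, (hi hd).of_even ?_⟩
      by_contra hodd
      obtain ⟨m, rfl⟩ := Nat.not_even_iff_odd.1 hodd
      -- An odd exponent would make the involution itself an autotopy.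
      rw [pow_succ, hA.conjEquiv_pow_of_even (even_two_mul m), one_mul,
        mul_mem_cancel_left hφ] at hmem
      exact hA.conjEquiv_notMem_autotopy hd hmem

theorem mem_autotopy_of_mem_Iso {α β γ δ φ : A ≃ₗ[k] A}
    (h : φ ∈ Iso (isotope α β) (isotope γ δ)) : φ ∈ autotopy k A := by
  refine ⟨γ * φ * α⁻¹, δ * φ * β⁻¹, fun x y => ?_⟩
  have h1 : φ (α (α⁻¹ x) * β (β⁻¹ y)) = γ (φ (α⁻¹ x)) * δ (φ (β⁻¹ y)) := h (α⁻¹ x) (β⁻¹ y)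
  have hx : α (α⁻¹ x) = x := α.apply_symm_apply x
  have hy : β (β⁻¹ y) = y := β.apply_symm_apply y
  rwa [hx, hy] at h1

theorem mem_Iso_of_triality {φ φ₁ φ₂ : A ≃ₗ[k] A} (h : ∀ x y, φ (x * y) = φ₁ x * φ₂ y)
    (α β : A ≃ₗ[k] A) : φ ∈ Iso (isotope α β) (isotope (φ₁ * α * φ⁻¹) (φ₂ * β * φ⁻¹)) := by
  intro x y
  change φ (α x * β y) = φ₁ (α (φ.symm (φ x))) * φ₂ (β (φ.symm (φ y)))
  rw [φ.symm_apply_apply, φ.symm_apply_apply, h]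

/-- The triality components `φ₁, φ₂` are determined by `φ`, `φ₁ 1` and `φ₂ 1`. -/
theorem IsHurwitz.exists_mul_of_triality (hA : IsHurwitz n) {φ φ₁ φ₂ : A ≃ₗ[k] A}
    (h : ∀ x y, φ (x * y) = φ₁ x * φ₂ y) :
    ∃ R L : A ≃ₗ[k] A, (R ∈ autotopy k A ∧ L ∈ autotopy k A) ∧
      (R : A →ₗ[k] A) = LinearMap.mulRight k (φ₂ 1) ∧
      (L : A →ₗ[k] A) = LinearMap.mulLeft k (φ₁ 1) ∧ φ₁ = R⁻¹ * φ ∧ φ₂ = L⁻¹ * φ := by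
  obtain ⟨ha, hb⟩ := hA.norm_ne_zero_of_autotopy h
  refine ⟨hA.mulRightEquiv _ hb, hA.mulLeftEquiv _ ha, ⟨hA.mulRightEquiv_mem_autotopy _ hb,
    hA.mulLeftEquiv_mem_autotopy _ ha⟩, rfl, rfl, ?_, ?_⟩
  · rw [eq_inv_mul_iff_mul_eq]
    ext x
    rw [LinearEquiv.mul_apply, hA.mulRightEquiv_apply, ← h, mul_one]
  · rw [eq_inv_mul_iff_mul_eq]
    ext x
    rw [LinearEquiv.mul_apply, hA.mulLeftEquiv_apply, ← h, one_mul]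

end Hurwitz

end HurwitzIsotope

/-! ### Triality components and isomorphisms of principal isotopes. -/

theorem proposition2p4 {k A : Type*} [Field k] [NonAssocRing A] [Module k A]
    [IsScalarTower k A A] [SMulCommClass k A A] [FiniteDimensional k A]
    (n : QuadraticForm k A) (hA : HurwitzIsotope.IsHurwitz n) :
    -- every element of `G(A)` has triality components, and these can be taken in `G(A)`
    (∀ φ ∈ HurwitzIsotope.G n, ∃ φ₁ ∈ HurwitzIsotope.G n, ∃ φ₂ ∈ HurwitzIsotope.G n,
      HurwitzIsotope.IsTriality n φ φ₁ φ₂) ∧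
    -- for any choice of triality components, `φ` is an isomorphism of the stated isotopes;
    -- `R` and `L` are the (invertible) multiplications by `φ₂(1)` and `φ₁(1)`
    (∀ φ ∈ HurwitzIsotope.G n, ∀ φ₁ φ₂ : A ≃ₗ[k] A, HurwitzIsotope.IsTriality n φ φ₁ φ₂ →
      ∃ R L : A ≃ₗ[k] A,
        (R : A →ₗ[k] A) = LinearMap.mulRight k (φ₂ 1) ∧
        (L : A →ₗ[k] A) = LinearMap.mulLeft k (φ₁ 1) ∧
        φ₁ = R⁻¹ * φ ∧ φ₂ = L⁻¹ * φ ∧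
        ∀ α β : A ≃ₗ[k] A,
          φ₁ * α * φ⁻¹ = R⁻¹ * φ * α * φ⁻¹ ∧
          φ₂ * β * φ⁻¹ = L⁻¹ * φ * β * φ⁻¹ ∧
          φ ∈ HurwitzIsotope.Iso (HurwitzIsotope.isotope α β)
            (HurwitzIsotope.isotope (φ₁ * α * φ⁻¹) (φ₂ * β * φ⁻¹))) ∧
    -- every isomorphism between principal isotopes lies in `G(A)`
    (∀ α β γ δ : A ≃ₗ[k] A,
      HurwitzIsotope.Iso (HurwitzIsotope.isotope α β) (HurwitzIsotope.isotope γ δ) ⊆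
        HurwitzIsotope.G n) ∧
    -- for `dim A ≥ 4`, no improper similitude is such an isomorphism
    (4 ≤ Module.finrank k A → ∀ φ ∈ HurwitzIsotope.GO n \ HurwitzIsotope.GOPlus n,
      ∀ α β γ δ : A ≃ₗ[k] A,
        φ ∉ HurwitzIsotope.Iso (HurwitzIsotope.isotope α β)
          (HurwitzIsotope.isotope γ δ)) := by
  refine ⟨fun φ hφ => ?_, fun φ _ φ₁ φ₂ h => ?_, fun α β γ δ φ hφ => ?_, fun hd φ hφ α β γ δ h => ?_⟩
  · obtain ⟨φ₁, φ₂, h⟩ := hA.mem_G_iff.1 hφ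
    obtain ⟨R, L, ⟨hR, hL⟩, -, -, h₁, h₂⟩ := hA.exists_mul_of_triality h
    have hφ' := hA.mem_G_iff.1 hφ
    -- The components are autotopies because they differ from `φ` by inverses of multiplications,
    -- which are autotopies.
    have m₁ : φ₁ ∈ HurwitzIsotope.autotopy k A := h₁ ▸ mul_mem (inv_mem hR) hφ'
    have m₂ : φ₂ ∈ HurwitzIsotope.autotopy k A := h₂ ▸ mul_mem (inv_mem hL) hφ'
    exact ⟨φ₁, hA.mem_G_iff.2 m₁, φ₂, hA.mem_G_iff.2 m₂, hA.autotopy_mem_GO m₁,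
      hA.autotopy_mem_GO m₂, h⟩
  · obtain ⟨R, L, -, hR, hL, h₁, h₂⟩ := hA.exists_mul_of_triality h.2.2
    exact ⟨R, L, hR, hL, h₁, h₂, fun α β => ⟨by rw [← h₁], by rw [← h₂],
      HurwitzIsotope.mem_Iso_of_triality h.2.2 α β⟩⟩
  · exact hA.mem_G_iff.2 (HurwitzIsotope.mem_autotopy_of_mem_Iso hφ)
  · have hG := hA.mem_G_iff.2 (HurwitzIsotope.mem_autotopy_of_mem_Iso h)
    rw [HurwitzIsotope.G, if_neg (by omega)] at hG
    exact hφ.2 hG
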